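/- Conventions. A vertex superalgebra $(V,\Omega,T,Y)$ is a complex superspace $V=V_{\bar 0}\oplus V_{\bar 1}$ (the $\pm1$-eigenspaces of a parity operator $\Gamma$, $\Gamma^2=1$) with an even vector $\Omega$ (the vacuum), an even endomorphism $T$ and a linear map $a\mapsto Y(a,z)=\sum_{n\in\mathbb Z}a_{(n)}z^{-n-1}$, $a_{(n)}\in\operatorname{End}(V)$, such that: $a_{(n)}V_q\subseteq V_{p+q}$ for $a\in V_p$; for all $a,b$ one has $a_{(n)}b=0$ for all large $n$; $[T,Y(a,z)]=\frac{d}{dz}Y(a,z)$; $Y(\Omega,z)=1_V$, $T\Omega=0$, $a_{(-1)}\Omega=a$; and any two fields $Y(a,z),Y(b,w)$ are mutually local, i.e. $(z-w)^N[Y(a,z),Y(b,w)]=0$ for some $N\in\mathbb Z_{\ge0}$, where $[\cdot,\cdot]$ is the graded commutator. A VOSA is a vertex superalgebra with an even vector $\nu$ such that the operators $L_n=\nu_{(n+1)}$ satisfy the Virasoro relations for some central charge, $L_{-1}=T$, $L_0$ is diagonalizable, the eigenspaces $V_d=\operatorname{Ker}(L_0-d)$ vanish for $d\notin\frac12\mathbb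 Z$ and are finite-dimensional, $V_{\bar 0}=\bigoplus_{d\in\mathbb Z}V_d$, $V_{\bar 1}=\bigoplus_{d\in\mathbb Z-\frac12}V_d$, and $V_d=\{0\}$ for all $d<N$, for some integer $N\le 0$. For $a\in V_d$ and $n\in\frac12\mathbb Z$ put $a_n=a_{(n+d-1)}$ if $n+d\in\mathbb Z$ and $a_n=0$ otherwise, and extend linearly to all $a\in V$. Write $(-1)^{2L_0^2+L_0}$ for the linear operator acting on $V_d$ as $(-1)^{2d^2+d}$. Let $V$ be a VOSA with a normalized scalar product $(\cdot|\cdot)$, that is, a positive-definite Hermitian form, linear in the second variable, with $(\Omega|\Omega)=1$. * $(V,(\cdot|\cdot))$ is **unitary** if there is a **PCT operator** for it: an antilinear bijection $\theta:V\to V$ with $\theta(a_{(n)}b)=\theta(a)_{(n)}\theta(b)$ for all $a,b\in V$, $n\in\mathbb Z$, with $\theta(\Omega)=\Omega$, $\theta(\nu)=\nu$, $\theta^2=1$, and $(Y(\theta(a),z)b|c)=(b|Y(e^{zL_1}(-1)^{2L_0^2+L_0}z^{-2L_0}a,z^{-1})c)$ for all $a,b,c\in V$, as formal Laurent series. * It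 has **unitary Möbius symmetry** if $(L_na|b)=(a|L_{-n}b)$ for all $a,b\in V$ and $n\in\{-1,0,1\}$. * An endomorphism $A^+$ of $V$ is the **adjoint** of $A\in\operatorname{End}(V)$ if $(a|Ab)=(A^+a|b)$ for all $a,b\in V$. The field $Y(a,z)$ **has a local adjoint** if every $a_{(n)}$ has an adjoint and $Y(a,z)^+:=\sum_{n\in\mathbb Z}a_{(n)}^+z^{n+1}$ is mutually local with $Y(b,z)$ for every $b\in V$. **Theorem.** (0) If $(V,(\cdot|\cdot))$ has unitary Möbius symmetry, then $a_{(n)}$ has an adjoint on $V$ for all $a\in V$ and $n\in\mathbb Z$. (1) If $V_0=\mathbb C\Omega$, then $(V,(\cdot|\cdot))$ is unitary if and only if it has unitary Möbius symmetry and every field $Y(a,z)$, $a\in V$, has a local adjoint. (2) Without the assumption $V_0=\mathbb C\Omega$, $(V,(\cdot|\cdot))$ is unitary if and only if there is an antilinear involution $a\mapsto\overline a$ of the vector space $V$ with $\overline\nu=\nu$ and $$(a_nb|c)=(b|\overline a_{-n}c)\qquad\text{for all }a,b,c\in V,\ n\in\tfrac12\mathbb Z.$$ (3) For every such involution, $\overline\Omega=\Omega$,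 and $\overline a=e^{L_1}(-1)^{2L_0^2+L_0}\theta(a)$ for all $a\in V$ and every PCT operator $\theta$ of $(V,(\cdot|\cdot))$. -/

import Mathlib

noncomputable section

namespace VertexSuper

open Module

/-- The sign `+1` for `p = 0` and `-1` for `p = 1`. -/
def paritySign (p : ZMod 2) : ℂ := if p = 0 then 1 else -1

section Distributions

variable {V : Type*} [AddCommGroup V] [Module ℂ V]

/-- The even part of an endomorphism of the superspace `V` with parity operator `Γ`. -/
def evenPart (Γ A : End ℂ V) : End ℂ V := (1 / 2 : ℂ) • (A + Γ * A * Γ)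

/-- The odd part of an endomorphism of the superspace `V` with parity operator `Γ`. -/
def oddPart (Γ A : End ℂ V) : End ℂ V := (1 / 2 : ℂ) • (A - Γ * A * Γ)

/-- The graded commutator, that is the bilinear extension of
`A B - (-1)^{p q} B A` for `A` of parity `p` and `B` of parity `q`. -/
def gradedCommutator (Γ A B : End ℂ V) : End ℂ V :=
  A * B - (B * evenPart Γ A + (Γ * B * Γ) * oddPart Γ A)

/-- On endomorphisms of parity `p` and `q`, the graded commutator is `A B - (-1)^{p q} B A`. -/
theorem gradedCommutator_of_parity (Γ A B : End ℂ V) (p q : ZMod 2)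
    (hA : Γ * A * Γ = paritySign p • A) (hB : Γ * B * Γ = paritySign q • B) :
    gradedCommutator Γ A B = A * B - paritySign (p * q) • (B * A) := by
  have h2 : ∀ r : ZMod 2, r = 0 ∨ r = 1 := by decide
  have hAA : (1 / 2 : ℂ) • (A + A) = A := by
    rw [← two_smul ℂ A, smul_smul]
    norm_num
  unfold gradedCommutator evenPart oddPart
  rw [hA, hB]
  rcases h2 p with rfl | rfl <;> rcases h2 q with rfl | rfl <;>
    simp [paritySign, -one_div, -smul_add, hAA]

/-- Multiplication by `z - w` of `D(z, w) = ∑ D m k z^{-m-1} w^{-k-1}`. -/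
def mulZSubW (D : ℤ → ℤ → End ℂ V) : ℤ → ℤ → End ℂ V :=
  fun m k => D (m + 1) k - D m (k + 1)

/-- `F(z) = ∑ F n z^{-n-1}` and `G(w) = ∑ G n w^{-n-1}` are mutually local:
`(z - w)^N [F(z), G(w)] = 0` for some (equivalently, for all large) `N`. -/
def MutuallyLocal (Γ : End ℂ V) (F G : ℤ → End ℂ V) : Prop :=
  ∃ N : ℕ, mulZSubW^[N] (fun m k => gradedCommutator Γ (F m) (G k)) = 0

end Distributions

/-- Vertex superalgebras on the complex vector space `V`; `Y a n` is the coefficient `a_(n)` of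
`z^{-n-1}` in the vertex operator `Y(a, z)`. -/
structure VertexSuperalgebra (V : Type*) [AddCommGroup V] [Module ℂ V] where
  /-- the parity operator -/
  Γ : End ℂ V
  Γ_sq : Γ * Γ = 1
  /-- the vacuum vector -/
  Ω : V
  /-- the infinitesimal translation operator -/
  T : End ℂ V
  /-- the state-field correspondence -/
  Y : V →ₗ[ℂ] (ℤ → End ℂ V)
  vacuum_even : Γ Ω = Ω
  T_even : Γ * T = T * Γ
  parity_preserving : ∀ (p q : ZMod 2) (a b : V) (n : ℤ),
    Γ a = paritySign p • a → Γ b = paritySign q • b →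
      Γ (Y a n b) = paritySign (p + q) • Y a n b
  field : ∀ a b : V, ∃ N : ℕ, ∀ n : ℤ, (N : ℤ) ≤ n → Y a n b = 0
  translation : ∀ (a : V) (n : ℤ), T * Y a n - Y a n * T = -(n : ℂ) • Y a (n - 1)
  vacuum_field : ∀ n : ℤ, Y Ω n = if n = -1 then 1 else 0
  T_vacuum : T Ω = 0
  creation : ∀ a : V, Y a (-1) Ω = a
  locality : ∀ a b : V, MutuallyLocal Γ (Y a) (Y b)

/-- Vertex operator superalgebras on the complex vector space `V`. The weight space of weight
`μ` is the eigenspace of `L_0 = ν_(1)` with eigenvalue `μ`. -/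
structure VOSA (V : Type*) [AddCommGroup V] [Module ℂ V] extends VertexSuperalgebra V where
  /-- the conformal vector -/
  ν : V
  conformal_even : Γ ν = ν
  virasoro : ∃ c : ℂ, ∀ n m : ℤ,
    Y ν (n + 1) * Y ν (m + 1) - Y ν (m + 1) * Y ν (n + 1) =
      ((n : ℂ) - m) • Y ν (n + m + 1) +
        (if n = -m then c * ((n : ℂ) ^ 3 - n) / 12 else 0) • (1 : End ℂ V)
  L_zero_diagonalizable : ⨆ μ : ℂ, End.eigenspace (Y ν 1) μ = ⊤
  L_neg_one : Y ν 0 = T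
  half_integer_weights : ∀ μ : ℂ, (∀ k : ℤ, μ ≠ (k : ℂ) / 2) → End.eigenspace (Y ν 1) μ = ⊥
  even_part : End.eigenspace Γ 1 = ⨆ n : ℤ, End.eigenspace (Y ν 1) (n : ℂ)
  odd_part : End.eigenspace Γ (-1) = ⨆ n : ℤ, End.eigenspace (Y ν 1) ((n : ℂ) - 1 / 2)
  finite_dim : ∀ k : ℤ, FiniteDimensional ℂ (End.eigenspace (Y ν 1) ((k : ℂ) / 2))
  bounded_below : ∃ N : ℤ, N ≤ 0 ∧
    ∀ k : ℤ, (k : ℝ) / 2 < N → End.eigenspace (Y ν 1) ((k : ℂ) / 2) = ⊥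

namespace VOSA

variable {V : Type*} [AddCommGroup V] [Module ℂ V] (X : VOSA V)

/-- The Virasoro modes `L_n = ν_(n+1)`. -/
def L (n : ℤ) : End ℂ V := X.Y X.ν (n + 1)

/-- The weight space `V_{k/2}`, for an integer `k`. -/
def W (k : ℤ) : Submodule ℂ V := End.eigenspace (X.L 0) ((k : ℂ) / 2)

theorem isInternal_W : DirectSum.IsInternal X.W := by
  have hL : X.L 0 = X.Y X.ν 1 := by simp [L]
  rw [DirectSum.isInternal_submodule_iff_iSupIndep_and_iSup_eq_top]
  constructor
  · have h := End.eigenspaces_iSupIndep (X.L 0)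
    refine h.comp (f := fun k : ℤ => (k : ℂ) / 2) ?_
    intro a b hab
    have : (a : ℂ) = b := by
      simpa using hab
    exact_mod_cast this
  · rw [eq_top_iff, ← X.L_zero_diagonalizable]
    refine iSup_le fun μ => ?_
    by_cases h : ∃ k : ℤ, μ = (k : ℂ) / 2
    · obtain ⟨k, rfl⟩ := h
      rw [← hL]
      exact le_iSup X.W k
    · rw [X.half_integer_weights μ (by simpa using h)]
      exact bot_le

theorem bijective_coe_W : Function.Bijective (DirectSum.coeLinearMap X.W) := X.isInternal_W

/-- The decomposition of `V` into its weight spaces. -/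
def decomp : V ≃ₗ[ℂ] DirectSum ℤ (fun k => X.W k) :=
  (LinearEquiv.ofBijective (DirectSum.coeLinearMap X.W) X.bijective_coe_W).symm

theorem decomp_of_mem {k : ℤ} {a : V} (ha : a ∈ X.W k) :
    X.decomp a = DirectSum.lof ℂ ℤ (fun k => X.W k) k ⟨a, ha⟩ := by
  unfold decomp
  rw [LinearEquiv.symm_apply_eq]
  exact (DirectSum.coeLinearMap_lof X.W k ⟨a, ha⟩).symm

/-- The mode `a_n` with `n = h / 2`, for an integer `h`: it is `a_(n + d - 1)` when `a` has weight
`d = k / 2` with `n + d` an integer, it is `0` when `n + d` is not an integer, and it is extended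
linearly to all `a`. -/
def mode (h : ℤ) : V →ₗ[ℂ] End ℂ V :=
  DirectSum.toModule ℂ ℤ (End ℂ V)
    (fun k => if Even (h + k) then
      (LinearMap.proj ((h + k) / 2 - 1) ∘ₗ X.Y) ∘ₗ (X.W k).subtype else 0) ∘ₗ
    X.decomp.toLinearMap

theorem mode_of_even {h k : ℤ} {a : V} (ha : a ∈ X.W k) (hk : Even (h + k)) :
    X.mode h a = X.Y a ((h + k) / 2 - 1) := by
  simp [mode, X.decomp_of_mem ha, DirectSum.toModule_lof, hk]

theorem mode_of_not_even {h k : ℤ} {a : V} (ha : a ∈ X.W k) (hk : ¬ Even (h + k)) :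
    X.mode h a = 0 := by
  simp [mode, X.decomp_of_mem ha, DirectSum.toModule_lof, hk]

/-- The sign `(-1)^{2 d^2 + d}` for `d = k / 2`; the exponent is the integer `k (k + 1) / 2`. -/
def weightSign (k : ℤ) : ℂ := (-1) ^ (k * (k + 1) / 2)

/-- The operator `(-1)^{2 L_0^2 + L_0}`. -/
def signOp : End ℂ V :=
  DirectSum.toModule ℂ ℤ V (fun k => weightSign k • (X.W k).subtype) ∘ₗ X.decomp.toLinearMap

theorem signOp_of_mem {k : ℤ} {a : V} (ha : a ∈ X.W k) : X.signOp a = weightSign k • a := by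
  simp [signOp, X.decomp_of_mem ha, DirectSum.toModule_lof]

theorem L_one_mem_W {k : ℤ} {a : V} (ha : a ∈ X.W k) : X.L 1 a ∈ X.W (k - 2) := by
  obtain ⟨c, hc⟩ := X.virasoro
  have h := LinearMap.congr_fun (hc 1 0) a
  have ha' : X.L 0 a = ((k : ℂ) / 2) • a := End.mem_eigenspace_iff.mp ha
  unfold W
  rw [End.mem_eigenspace_iff]
  simp only [L] at ha' ⊢
  simp only [LinearMap.sub_apply, Module.End.mul_apply, LinearMap.add_apply,
    LinearMap.smul_apply, ha', map_smul] at h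
  norm_num at h
  norm_num
  rw [sub_div, sub_smul, ← sub_eq_iff_eq_add.mpr (sub_eq_iff_eq_add'.mp h)]
  norm_num

theorem L_one_pow_mem_W {k : ℤ} {a : V} (ha : a ∈ X.W k) (l : ℕ) :
    (X.L 1 ^ l) a ∈ X.W (k - 2 * l) := by
  induction l with
  | zero => simpa using ha
  | succ l ih =>
    have h := X.L_one_mem_W ih
    rw [pow_succ', Module.End.mul_apply]
    convert h using 2
    push_cast
    ring

/-- On a given vector only finitely many powers of `L_1` are non-zero, so that sums over powers
of `L_1` are finite. -/
theorem exists_L_one_pow_eq_zero (a : V) : ∃ N : ℕ, ∀ l : ℕ, N ≤ l → (X.L 1 ^ l) a = 0 := by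
  have hL : X.L 0 = X.Y X.ν 1 := by simp [L]
  have ha : a ∈ ⨆ k, X.W k := by
    rw [(DirectSum.isInternal_submodule_iff_iSupIndep_and_iSup_eq_top _).mp X.isInternal_W |>.2]
    trivial
  induction ha using Submodule.iSup_induction' with
  | mem k x hx =>
    obtain ⟨M, -, hM⟩ := X.bounded_below
    refine ⟨(k - 2 * M + 1).toNat, fun l hl => ?_⟩
    have h1 := X.L_one_pow_mem_W hx l
    have h2 : X.W (k - 2 * l) = ⊥ := by
      have h3 : (k - 2 * l : ℤ) < 2 * M := by
        have := Int.self_le_toNat (k - 2 * M + 1)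
        have hl' : ((k - 2 * M + 1).toNat : ℤ) ≤ l := by exact_mod_cast hl
        have : (k - 2 * M + 1 : ℤ) ≤ l := this.trans hl'
        have : (0 : ℤ) ≤ l := by positivity
        linarith
      have h4 : ((k - 2 * l : ℤ) : ℝ) < 2 * M := by exact_mod_cast h3
      have := hM (k - 2 * l) (by linarith)
      rwa [← hL] at this
    rw [h2] at h1
    simpa using h1
  | zero => exact ⟨0, fun l _ => map_zero _⟩
  | add x y _ _ hx hy =>
    obtain ⟨N, hN⟩ := hx
    obtain ⟨M, hM⟩ := hy
    refine ⟨max N M, fun l hl => ?_⟩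
    rw [map_add, hN l (le_trans (le_max_left _ _) hl), hM l (le_trans (le_max_right _ _) hl),
      add_zero]

/-- `e^{L_1} a = ∑_l L_1^l a / l!`. -/
def expLOne (a : V) : V := ∑ᶠ l : ℕ, (1 / (l.factorial : ℂ)) • (X.L 1 ^ l) a

/-- A scalar product (antilinear in the first, linear in the second variable) is normalized. -/
def IsNormalized (s : InnerProductSpace.Core ℂ V) : Prop := s.inner X.Ω X.Ω = 1

/-- The invariance of the scalar product with respect to `θ`:
`(Y(θ a, z) b | c) = (b | Y(e^{z L_1} (-1)^{2 L_0^2 + L_0} z^{-2 L_0} a, z^{-1}) c)`.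
For `a` of weight `k / 2`, the right hand side is
`(-1)^{2 d^2 + d} ∑_l ∑_n (b | (L_1^l a)_(n) c) z^{l - k + n + 1} / l!`, and
the coefficients of `z^{-m-1}` on both sides are compared. -/
def IsInvariant (s : InnerProductSpace.Core ℂ V) (θ : V →ₗ⋆[ℂ] V) : Prop :=
  ∀ (k : ℤ) (a : V), a ∈ X.W k → ∀ (b c : V) (m : ℤ),
    s.inner (X.Y (θ a) m b) c =
      weightSign k * ∑ᶠ l : ℕ, (1 / (l.factorial : ℂ)) *
        s.inner b (X.Y ((X.L 1 ^ l) a) (k - m - 2 - l) c)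

/-- `θ` is a PCT operator associated with the scalar product `s`: an antilinear automorphism of
the vertex operator superalgebra that is an involution (hence bijective) and
with respect to which `s` is invariant. -/
structure IsPCT (s : InnerProductSpace.Core ℂ V) (θ : V →ₗ⋆[ℂ] V) : Prop where
  map_product : ∀ (a b : V) (n : ℤ), θ (X.Y a n b) = X.Y (θ a) n (θ b)
  map_vacuum : θ X.Ω = X.Ω
  map_conformal : θ X.ν = X.ν
  involutive : ∀ a : V, θ (θ a) = a
  invariant : X.IsInvariant s θ

/-- The vertex operator superalgebra with the scalar product `s` is unitary. -/
def IsUnitary (s : InnerProductSpace.Core ℂ V) : Prop :=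
  X.IsNormalized s ∧ ∃ θ : V →ₗ⋆[ℂ] V, X.IsPCT s θ

/-- Unitary Möbius symmetry. -/
def HasUnitaryMobiusSymmetry (s : InnerProductSpace.Core ℂ V) : Prop :=
  ∀ n : ℤ, n ∈ ({-1, 0, 1} : Set ℤ) → ∀ a b : V, s.inner (X.L n a) b = s.inner a (X.L (-n) b)

/-- `B` is the adjoint `A⁺` of `A` on `V`. -/
def IsAdjoint (s : InnerProductSpace.Core ℂ V) (A B : End ℂ V) : Prop :=
  ∀ a b : V, s.inner a (A b) = s.inner (B a) b

/-- The field `Y(a, z)` has a local adjoint: its coefficients `a_(n)` have adjoints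
`a_(n)⁺ = B n`, and `Y(a, z)⁺ = ∑ a_(n)⁺ z^{n+1} = ∑ a_(-n-2)⁺ z^{-n-1}` is mutually local with
`Y(b, z)` for every `b`. -/
def HasLocalAdjoint (s : InnerProductSpace.Core ℂ V) (a : V) : Prop :=
  ∃ B : ℤ → End ℂ V, (∀ n : ℤ, IsAdjoint s (X.Y a n) (B n)) ∧
    ∀ b : V, MutuallyLocal X.Γ (fun n => B (-n - 2)) (X.Y b)

/-- `C` is an antilinear involution `a ↦ ā` of `V` with `ν̄ = ν` and `(a_n b | c) = (b | ā_{-n} c)`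
for all `a, b, c` and all half-integers `n = h / 2`. -/
structure IsAdjointInvolution (s : InnerProductSpace.Core ℂ V) (C : V →ₗ⋆[ℂ] V) : Prop where
  involutive : ∀ a : V, C (C a) = a
  map_conformal : C X.ν = X.ν
  adjoint : ∀ (a b c : V) (h : ℤ), s.inner (X.mode h a b) c = s.inner b (X.mode (-h) (C a) c)

end VOSA

end VertexSuper

end

/-! Everything is expressed through adjoints of modes. Write `R = e^{L_1} (-1)^{2 L_0^2 + L_0}`
(`flip`); it is an involution because the sign operator anticommutes with `L_1`. Comparing
coefficients, invariance of the scalar product says that `(θ a)_n` has adjoint `(R a)_{-n}`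
(`isInvariant_iff`). Adjoints are unique and a vector is determined by its modes (`eq_of_mode_eq`),
so `θ` and the involution `C : a ↦ ā` determine each other by `C = R θ`. This gives (3) and one half
of (2).

For the converse in (2) put `θ = R C` (`pct`). Taking adjoints of `L_n` and of `[L_1, a_n]` yields
Möbius symmetry and shows that `C` satisfies the same relations with `T`, `L_0`, `L_1` as `R`; hence
`θ` commutes with these operators and `θ² = 1`. The real work is that `θ` preserves all products
(`pct_Y`). Positivity excludes negative weights and makes the vectors `T^j a` with `a` quasi-primary
span `V`. For `a`, `b` quasi-primary and `n ≥ 0`, Borcherds' commutator formula makes the modes of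
`a_(n) b` coefficients of `(z - w)^n [Y(a, z), Y(b, w)]`; after adjunction the same formula produces
exactly the binomial coefficients of `e^{L_1}` (`pct_Y_natCast_quasiPrimary`). Weight zero is
separate: those fields are constant and central. These cases suffice for antiunitarity of `θ`
(`inner_pct_pct`), and adjunction then gives the products with `n < 0`.

In (1), the adjoint of a quasi-primary field is, up to a power of `z`, translation covariant; being
local, it is a vertex operator by Goddard's uniqueness theorem (`exists_Y_adj`). This produces `C`,
and `V_0 = ℂΩ` forces `C ν = ν`. Part (0) is Riesz's theorem on finite-dimensional weight spaces.
The commutator formula itself is derived from locality by Goddard's theorem and a form of Dong's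
lemma. -/

namespace VertexSuper

open Module

/-! ### Vectors killed by a power of an operator -/

section Nilpotent

variable {M M' : Type*} [AddCommGroup M] [Module ℂ M] [AddCommGroup M'] [Module ℂ M']

/-- The vectors annihilated by some power of `T`. -/
abbrev nil (T : End ℂ M) : Submodule ℂ M := T.maxGenEigenspace 0

theorem mem_nil {T : End ℂ M} {x : M} : x ∈ nil T ↔ ∃ k : ℕ, (T ^ k) x = 0 := by
  simp [nil, End.mem_maxGenEigenspace]

theorem pow_intertwine {T : End ℂ M} {T' : End ℂ M'} (φ : M →ₗ[ℂ] M')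
    (h : ∀ x, φ (T x) = T' (φ x)) (k : ℕ) (x : M) : φ ((T ^ k) x) = (T' ^ k) (φ x) := by
  induction k generalizing x with
  | zero => rfl
  | succ k ih => rw [pow_succ, pow_succ, End.mul_apply, End.mul_apply, ih, h]

theorem map_mem_nil {T : End ℂ M} {T' : End ℂ M'} (φ : M →ₗ[ℂ] M')
    (h : ∀ x, φ (T x) = T' (φ x)) {x : M} (hx : x ∈ nil T) : φ x ∈ nil T' := by
  obtain ⟨k, hk⟩ := mem_nil.mp hx
  exact mem_nil.mpr ⟨k, by rw [← pow_intertwine φ h, hk, map_zero]⟩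

theorem mem_nil_mul_left {S T : End ℂ M} (h : Commute S T) {x : M} (hx : x ∈ nil T) :
    x ∈ nil (S * T) := by
  obtain ⟨k, hk⟩ := mem_nil.mp hx
  exact mem_nil.mpr ⟨k, by rw [h.mul_pow, End.mul_apply, hk, map_zero]⟩

theorem mem_nil_mul_right {S T : End ℂ M} (h : Commute S T) {x : M} (hx : x ∈ nil S) :
    x ∈ nil (S * T) := by
  rw [h.eq]
  exact mem_nil_mul_left h.symm hx

end Nilpotent

/-! ### Formal distributions in two and three variables -/

section Formal

variable (M : Type*) [AddCommGroup M] [Module ℂ M]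

/-- Multiplication by `z - w` on formal distributions `D(z, w)`. -/
def zSubW : End ℂ (ℤ → ℤ → M) where
  toFun D := fun m k => D (m + 1) k - D m (k + 1)
  map_add' D E := by
    funext m k
    simp only [Pi.add_apply]
    abel
  map_smul' c D := by
    funext m k
    simp [smul_sub]

/-- Multiplication by `z - w` on formal distributions `D(z, w, x)`. -/
def zSubW₃ : End ℂ (ℤ → ℤ → ℤ → M) where
  toFun D := fun p q r => D (p + 1) q r - D p (q + 1) r
  map_add' D E := by
    funext m k r
    simp only [Pi.add_apply]
    abel
  map_smul' c D := by
    funext m k r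
    simp [smul_sub]

/-- Multiplication by `w - x` on formal distributions `D(z, w, x)`. -/
def wSubX₃ : End ℂ (ℤ → ℤ → ℤ → M) where
  toFun D := fun p q r => D p (q + 1) r - D p q (r + 1)
  map_add' D E := by
    funext m k r
    simp only [Pi.add_apply]
    abel
  map_smul' c D := by
    funext m k r
    simp [smul_sub]

/-- Multiplication by `z - x` on formal distributions `D(z, w, x)`. -/
def zSubX₃ : End ℂ (ℤ → ℤ → ℤ → M) where
  toFun D := fun p q r => D (p + 1) q r - D p q (r + 1)
  map_add' D E := by
    funext m k r
    simp only [Pi.add_apply]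
    abel
  map_smul' c D := by
    funext m k r
    simp [smul_sub]

theorem commute_wSubX_zSubX : Commute (wSubX₃ M) (zSubX₃ M) := by
  ext D p q r
  simp only [wSubX₃, zSubX₃, End.mul_apply, LinearMap.coe_mk, AddHom.coe_mk]
  abel

theorem commute_wSubX_zSubW : Commute (wSubX₃ M) (zSubW₃ M) := by
  ext D p q r
  simp only [wSubX₃, zSubW₃, End.mul_apply, LinearMap.coe_mk, AddHom.coe_mk]
  abel

theorem commute_zSubX_zSubW : Commute (zSubX₃ M) (zSubW₃ M) := by
  ext D p q r
  simp only [zSubX₃, zSubW₃, End.mul_apply, LinearMap.coe_mk, AddHom.coe_mk]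
  abel

variable {M}

theorem zSubW_apply (D : ℤ → ℤ → M) (m k : ℤ) : zSubW M D m k = D (m + 1) k - D m (k + 1) := rfl

theorem zSubW_pow_succ_apply (n : ℕ) (D : ℤ → ℤ → M) (m k : ℤ) :
    (zSubW M ^ (n + 1)) D m k = (zSubW M ^ n) D (m + 1) k - (zSubW M ^ n) D m (k + 1) := by
  rw [pow_succ', End.mul_apply, zSubW_apply]

/-- If `h(w, x) δ(z - w)` is annihilated by a power of `(w - x)(z - x)`, then `h(w, x)` is
annihilated by a power of `w - x`. -/
theorem mem_nil_of_diagonal {h : ℤ → ℤ → M}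
    (hh : (fun p q r => h (p + q) r) ∈ nil (wSubX₃ M * zSubX₃ M)) : h ∈ nil (zSubW M) := by
  let φ : (ℤ → ℤ → M) →ₗ[ℂ] (ℤ → ℤ → ℤ → M) :=
    { toFun := fun h p q r => h (p + q) r
      map_add' := fun _ _ => rfl
      map_smul' := fun _ _ => rfl }
  -- On `h(w, x) δ(z - w)` the factors `w - x` and `z - x` act alike, so their product acts as a
  -- square on `h`.
  have hφ : ∀ x, φ ((zSubW M ^ 2) x) = (wSubX₃ M * zSubX₃ M) (φ x) := by
    intro x
    funext p q r
    simp only [φ, wSubX₃, zSubX₃, zSubW, pow_two, End.mul_apply, LinearMap.coe_mk, AddHom.coe_mk]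
    rw [show p + q + 1 = p + (q + 1) by ring, show p + (q + 1) + 1 = p + 1 + (q + 1) by ring,
      show p + 1 + q = p + (q + 1) by ring]
  obtain ⟨k, hk⟩ := mem_nil.mp hh
  have h1 : φ (((zSubW M ^ 2) ^ k) h) = 0 := (pow_intertwine φ hφ k h).trans hk
  refine mem_nil.mpr ⟨2 * k, ?_⟩
  rw [pow_mul]
  funext m r
  simpa [φ] using congr_fun (congr_fun (congr_fun h1 0) m) r

end Formal

/-! ### Locality with a fixed sign, and Dong's lemma -/

section Locality

variable {V : Type*} [AddCommGroup V] [Module ℂ V]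

theorem mulZSubW_iterate (N : ℕ) (D : ℤ → ℤ → End ℂ V) :
    mulZSubW^[N] D = (zSubW (End ℂ V) ^ N) D := by
  rw [End.pow_apply]
  rfl

/-- The distribution `F(z) G(w) - ε G(w) F(z)`. -/
def signComm (ε : ℂ) (F G : ℤ → End ℂ V) : ℤ → ℤ → End ℂ V :=
  fun m k => F m * G k - ε • (G k * F m)

/-- Locality of two fields with a fixed sign `ε` in the commutator. -/
def SignLocal (ε : ℂ) (F G : ℤ → End ℂ V) : Prop := signComm ε F G ∈ nil (zSubW (End ℂ V))

/-- Locality becomes membership in a submodule that is preserved by linear maps intertwining the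
multiplications, so exponents need not be tracked. -/
theorem mutuallyLocal_iff (Γ : End ℂ V) (F G : ℤ → End ℂ V) :
    MutuallyLocal Γ F G ↔
      (fun m k => gradedCommutator Γ (F m) (G k)) ∈ nil (zSubW (End ℂ V)) := by
  simp only [MutuallyLocal, mem_nil, mulZSubW_iterate]

theorem MutuallyLocal.signLocal {Γ : End ℂ V} {F G : ℤ → End ℂ V} (h : MutuallyLocal Γ F G)
    {p q : ZMod 2} (hF : ∀ n, Γ * F n * Γ = paritySign p • F n)
    (hG : ∀ n, Γ * G n * Γ = paritySign q • G n) : SignLocal (paritySign (p * q)) F G := by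
  rw [mutuallyLocal_iff] at h
  unfold SignLocal
  convert h using 1
  funext m k
  rw [gradedCommutator_of_parity Γ _ _ p q (hF m) (hG k), signComm]

theorem SignLocal.sub {ε : ℂ} {F F' G : ℤ → End ℂ V} (h : SignLocal ε F G)
    (h' : SignLocal ε F' G) : SignLocal ε (F - F') G := by
  have := sub_mem h h'
  unfold SignLocal
  convert this using 1
  funext m k
  simp only [signComm, Pi.sub_apply, sub_mul, mul_sub, smul_sub]
  abel

/-- Composition with an operator that commutes with all coefficients of `G`. -/
theorem SignLocal.mul_left {ε : ℂ} {F G : ℤ → End ℂ V} (h : SignLocal ε F G) (A : End ℂ V)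
    (hA : ∀ n, A * G n = G n * A) : SignLocal ε (fun n => A * F n) G := by
  let φ : (ℤ → ℤ → End ℂ V) →ₗ[ℂ] (ℤ → ℤ → End ℂ V) :=
    { toFun := fun D m k => A * D m k
      map_add' := fun D E => by
        funext m k
        simp [mul_add]
      map_smul' := fun c D => by
        funext m k
        simp }
  have := map_mem_nil (T' := zSubW (End ℂ V)) φ (fun D => by
    funext m k
    simp [φ, zSubW_apply, mul_sub]) h
  unfold SignLocal
  convert this using 1
  funext m k
  simp only [signComm, φ, LinearMap.coe_mk, AddHom.coe_mk, mul_sub, mul_smul_comm]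
  rw [← mul_assoc (G k), ← hA, mul_assoc, mul_assoc]

/-- The hypothesis says that only nonnegative powers of `w` occur, so `w = 0` may be substituted;
`(z - w)^N` becomes `z^N`, a shift of `m`. -/
theorem zSubW_pow_apply_neg_one {f : ℤ → ℤ → End ℂ V} {v : V}
    (h : ∀ m k, 0 ≤ k → f m k v = 0) (N : ℕ) :
    (∀ m k, 0 ≤ k → (zSubW (End ℂ V) ^ N) f m k v = 0) ∧
      ∀ m, (zSubW (End ℂ V) ^ N) f m (-1) v = f (m + N) (-1) v := by
  induction N with
  | zero => exact ⟨h, by simp⟩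
  | succ N ih =>
    refine ⟨fun m k hk => ?_, fun m => ?_⟩
    · rw [zSubW_pow_succ_apply, LinearMap.sub_apply, ih.1 _ _ hk, ih.1 _ _ (by omega), sub_zero]
    · rw [zSubW_pow_succ_apply, LinearMap.sub_apply, ih.2, ih.1 _ _ (by omega), sub_zero]
      push_cast
      congr 2
      ring

/-- A form of Dong's lemma: distributions `(z - w)^n [F(z), G(w)]` are local with respect to a
field `C(x)` that is local with respect to `F` and `G`. -/
theorem signComm_signComm_mem_nil {α β γ : ℂ} {F G C : ℤ → End ℂ V}
    (hFC : SignLocal β F C) (hGC : SignLocal γ G C) (n : ℕ) :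
    (fun p q r => (zSubW (End ℂ V) ^ n) (signComm α F G) p q * C r -
      (β * γ) • (C r * (zSubW (End ℂ V) ^ n) (signComm α F G) p q)) ∈
        nil (wSubX₃ (End ℂ V) * zSubX₃ (End ℂ V)) := by
  let φ : (ℤ → ℤ → End ℂ V) →ₗ[ℂ] (ℤ → ℤ → ℤ → End ℂ V) :=
    { toFun := fun D p q r => D p q * C r - (β * γ) • (C r * D p q)
      map_add' := fun D E => by
        funext p q r
        simp only [Pi.add_apply, add_mul, mul_add, smul_add]
        abel
      map_smul' := fun c D => by
        funext p q r
        simp only [Pi.smul_apply, smul_mul_assoc, mul_smul_comm, smul_sub, RingHom.id_apply]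
        rw [smul_comm] }
  have hφ : ∀ D, φ (zSubW (End ℂ V) D) = zSubW₃ (End ℂ V) (φ D) := by
    intro D
    funext p q r
    simp only [φ, zSubW, zSubW₃, LinearMap.coe_mk, AddHom.coe_mk, sub_mul, mul_sub, smul_sub]
    abel
  have h1 := pow_intertwine φ hφ n (signComm α F G)
  change φ ((zSubW (End ℂ V) ^ n) (signComm α F G)) ∈ _
  rw [h1]
  have hcomm : Commute (wSubX₃ (End ℂ V) * zSubX₃ (End ℂ V)) (zSubW₃ (End ℂ V) ^ n) :=
    ((commute_wSubX_zSubW _).mul_left (commute_zSubX_zSubW _)).pow_right n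
  -- Multiplication by `(z - w)^n` commutes with `(w - x)(z - x)`, which reduces the claim to `n =
  -- 0`.
  suffices hmem : φ (signComm α F G) ∈ nil (wSubX₃ (End ℂ V) * zSubX₃ (End ℂ V)) from
    map_mem_nil _ (fun x => (LinearMap.congr_fun hcomm.eq x).symm) hmem
  have hwx := commute_wSubX_zSubX (End ℂ V)
  let left (A : ℤ → End ℂ V) : (ℤ → ℤ → End ℂ V) →ₗ[ℂ] (ℤ → ℤ → ℤ → End ℂ V) :=
    { toFun := fun D p q r => A p * D q r
      map_add' := fun D E => by
        funext p q r
        simp [mul_add]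
      map_smul' := fun c D => by
        funext p q r
        simp }
  let right (A : ℤ → End ℂ V) : (ℤ → ℤ → End ℂ V) →ₗ[ℂ] (ℤ → ℤ → ℤ → End ℂ V) :=
    { toFun := fun D p q r => D q r * A p
      map_add' := fun D E => by
        funext p q r
        simp [add_mul]
      map_smul' := fun c D => by
        funext p q r
        simp }
  let left' (A : ℤ → End ℂ V) : (ℤ → ℤ → End ℂ V) →ₗ[ℂ] (ℤ → ℤ → ℤ → End ℂ V) :=
    { toFun := fun D p q r => A q * D p r
      map_add' := fun D E => by
        funext p q r
        simp [mul_add]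
      map_smul' := fun c D => by
        funext p q r
        simp }
  let right' (A : ℤ → End ℂ V) : (ℤ → ℤ → End ℂ V) →ₗ[ℂ] (ℤ → ℤ → ℤ → End ℂ V) :=
    { toFun := fun D p q r => D p r * A q
      map_add' := fun D E => by
        funext p q r
        simp [add_mul]
      map_smul' := fun c D => by
        funext p q r
        simp }
  have e1 : left F (signComm γ G C) ∈ nil (wSubX₃ (End ℂ V) * zSubX₃ (End ℂ V)) := by
    refine mem_nil_mul_right hwx (map_mem_nil (left F) (fun D => ?_) hGC)
    funext p q r
    simp [left, zSubW, wSubX₃, mul_sub]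
  have e2 : right' G (signComm β F C) ∈ nil (wSubX₃ (End ℂ V) * zSubX₃ (End ℂ V)) := by
    refine mem_nil_mul_left hwx (map_mem_nil (right' G) (fun D => ?_) hFC)
    funext p q r
    simp [right', zSubW, zSubX₃, sub_mul]
  have e3 : left' G (signComm β F C) ∈ nil (wSubX₃ (End ℂ V) * zSubX₃ (End ℂ V)) := by
    refine mem_nil_mul_left hwx (map_mem_nil (left' G) (fun D => ?_) hFC)
    funext p q r
    simp [left', zSubW, zSubX₃, mul_sub]
  have e4 : right F (signComm γ G C) ∈ nil (wSubX₃ (End ℂ V) * zSubX₃ (End ℂ V)) := by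
    refine mem_nil_mul_right hwx (map_mem_nil (right F) (fun D => ?_) hGC)
    funext p q r
    simp [right, zSubW, wSubX₃, sub_mul]
  -- Jacobi-type expansion of `[[F, G], C]`: each term contains `[G, C]` or `[F, C]`, killed by a
  -- power of `w - x` or of `z - x`.
  have key : φ (signComm α F G) = left F (signComm γ G C) + γ • right' G (signComm β F C) -
      α • (left' G (signComm β F C) + β • right F (signComm γ G C)) := by
    funext p q r
    simp only [φ, left, right, left', right', signComm, LinearMap.coe_mk, AddHom.coe_mk,
      Pi.add_apply, Pi.sub_apply, Pi.smul_apply, mul_sub, sub_mul, smul_sub, smul_add,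
      mul_smul_comm, smul_mul_assoc, smul_smul, mul_assoc]
    module
  rw [key]
  exact sub_mem (add_mem e1 (Submodule.smul_mem _ _ e2))
    (Submodule.smul_mem _ _ (add_mem e3 (Submodule.smul_mem _ _ e4)))

end Locality

end VertexSuper

/-! ### Goddard's uniqueness theorem and Borcherds' commutator formula -/

namespace VertexSuper

open Module

theorem paritySign_add (p q : ZMod 2) : paritySign (p + q) = paritySign p * paritySign q := by
  have h2 : ∀ r : ZMod 2, r = 0 ∨ r = 1 := by decide
  rcases h2 p with rfl | rfl <;> rcases h2 q with rfl | rfl <;> simp [paritySign]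
  decide

theorem paritySign_mul_self (p : ZMod 2) : paritySign p * paritySign p = 1 := by
  unfold paritySign
  split_ifs <;> norm_num

namespace VertexSuperalgebra

variable {V : Type*} [AddCommGroup V] [Module ℂ V] (X : VertexSuperalgebra V)

theorem parity_induction {P : V → Prop} (h : ∀ (p : ZMod 2) (a : V), X.Γ a = paritySign p • a → P a)
    (hadd : ∀ a b, P a → P b → P (a + b)) (a : V) : P a := by
  have hΓ : ∀ x, X.Γ (X.Γ x) = x := fun x => LinearMap.congr_fun X.Γ_sq x
  have ha : a = (1 / 2 : ℂ) • (a + X.Γ a) + (1 / 2 : ℂ) • (a - X.Γ a) := by module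
  rw [ha]
  refine hadd _ _ (h 0 _ ?_) (h 1 _ ?_)
  · simp [paritySign, hΓ, add_comm]
  · rw [map_smul, map_sub, hΓ, paritySign, if_neg one_ne_zero]
    module

theorem Γ_Y_Γ {p : ZMod 2} {a : V} (ha : X.Γ a = paritySign p • a) (n : ℤ) :
    X.Γ * X.Y a n * X.Γ = paritySign p • X.Y a n := by
  ext b
  refine X.parity_induction (P := fun b => (X.Γ * X.Y a n * X.Γ) b = (paritySign p • X.Y a n) b)
    (fun q b hb => ?_) (fun b c hb hc => by rw [map_add, hb, hc, map_add]) b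
  rw [End.mul_apply, End.mul_apply, hb, map_smul, map_smul, X.parity_preserving p q a b n ha hb,
    smul_smul, LinearMap.smul_apply, paritySign_add, mul_left_comm, paritySign_mul_self, mul_one]

theorem signLocal_Y {p q : ZMod 2} {a b : V} (ha : X.Γ a = paritySign p • a)
    (hb : X.Γ b = paritySign q • b) : SignLocal (paritySign (p * q)) (X.Y a) (X.Y b) :=
  (X.locality a b).signLocal (X.Γ_Y_Γ ha) (X.Γ_Y_Γ hb)

/-- Fields `F(z)` with `[T, F(z)] = F'(z)`, with `F(z)Ω` a formal Laurent series. -/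
structure Covariant (F : ℤ → End ℂ V) : Prop where
  translation : ∀ n : ℤ, X.T * F n - F n * X.T = -(n : ℂ) • F (n - 1)
  field : ∃ N : ℕ, ∀ n : ℤ, (N : ℤ) ≤ n → F n X.Ω = 0

theorem covariant_Y (a : V) : X.Covariant (X.Y a) := ⟨X.translation a, X.field a X.Ω⟩

variable {X}

theorem Covariant.sub {F G : ℤ → End ℂ V} (hF : X.Covariant F) (hG : X.Covariant G) :
    X.Covariant (F - G) := by
  refine ⟨fun n => ?_, ?_⟩
  · have h1 := hF.translation n
    have h2 := hG.translation n
    simp only [Pi.sub_apply, mul_sub, sub_mul, smul_sub]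
    rw [← h1, ← h2]
    abel
  · obtain ⟨N, hN⟩ := hF.field
    obtain ⟨M, hM⟩ := hG.field
    refine ⟨max N M, fun n hn => ?_⟩
    push_cast at hn
    simp [hN n (by omega), hM n (by omega)]

theorem Covariant.T_apply_vacuum {F : ℤ → End ℂ V} (hF : X.Covariant F) (n : ℤ) :
    X.T (F n X.Ω) = -(n : ℂ) • F (n - 1) X.Ω := by
  have := LinearMap.congr_fun (hF.translation n) X.Ω
  simpa [X.T_vacuum] using this

/-- The relation `T F_(n+1) Ω = -(n+1) F_(n) Ω` propagates vanishing downwards from large indices,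
its factor being nonzero while `n ≥ 0`. -/
theorem Covariant.apply_vacuum {F : ℤ → End ℂ V} (hF : X.Covariant F) {n : ℤ} (hn : 0 ≤ n) :
    F n X.Ω = 0 := by
  obtain ⟨N, hN⟩ := hF.field
  have key : ∀ j : ℕ, ∀ n : ℤ, 0 ≤ n → (N : ℤ) ≤ n + j → F n X.Ω = 0 := by
    intro j
    induction j with
    | zero => exact fun n _ h => hN n (by simpa using h)
    | succ j ih =>
      intro n hn h
      have h1 := ih (n + 1) (by omega) (by push_cast at h; omega)
      have h2 := hF.T_apply_vacuum (n + 1)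
      rw [h1, map_zero, add_sub_cancel_right] at h2
      have h3 : -((n + 1 : ℤ) : ℂ) ≠ 0 := by
        rw [neg_ne_zero]
        exact_mod_cast (by omega : n + 1 ≠ 0)
      exact (smul_eq_zero.mp h2.symm).resolve_left h3
  exact key N n hn (by omega)

/-- Below `-1` the factors of the same recursion are nonzero again, so the coefficient at `-1`
controls all of `F(z)Ω`. -/
theorem Covariant.apply_vacuum_eq_zero {F : ℤ → End ℂ V} (hF : X.Covariant F)
    (h : F (-1) X.Ω = 0) (n : ℤ) : F n X.Ω = 0 := by
  have key : ∀ j : ℕ, F (-1 - j) X.Ω = 0 := by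
    intro j
    induction j with
    | zero => simpa using h
    | succ j ih =>
      have h2 := hF.T_apply_vacuum (-1 - j)
      rw [ih, map_zero] at h2
      have h3 : -((-1 - j : ℤ) : ℂ) ≠ 0 := by
        rw [neg_ne_zero]
        exact_mod_cast (by omega : (-1 - j : ℤ) ≠ 0)
      have := (smul_eq_zero.mp h2.symm).resolve_left h3
      push_cast
      rwa [← sub_sub]
  rcases le_or_gt 0 n with hn | hn
  · exact hF.apply_vacuum hn
  · obtain ⟨j, hj⟩ := Int.eq_ofNat_of_zero_le (show 0 ≤ -1 - n by omega)
    rw [show n = -1 - (j : ℤ) by omega]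
    exact key j

/-- Goddard's uniqueness theorem for the zero field. -/
theorem Covariant.eq_zero {F : ℤ → End ℂ V} (hF : X.Covariant F) (h : F (-1) X.Ω = 0)
    (hloc : ∀ (q : ZMod 2) (b : V), X.Γ b = paritySign q • b → ∃ ε, SignLocal ε F (X.Y b)) :
    F = 0 := by
  have h0 := hF.apply_vacuum_eq_zero h
  funext m
  ext b
  refine X.parity_induction (P := fun b => F m b = 0) (fun q b hb => ?_)
    (fun b c hb hc => by rw [map_add, hb, hc, add_zero]) b
  obtain ⟨ε, hε⟩ := hloc q b hb
  obtain ⟨N, hN⟩ := mem_nil.mp hε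
  -- Since `F(z)Ω = 0`, locality applied to `Ω` at `w = 0` reads `z^N F(z) b = 0`; the index `m - N`
  -- undoes the shift by `z^N`.
  have h1 := (zSubW_pow_apply_neg_one (f := signComm ε F (X.Y b)) (v := X.Ω) (fun m k hk => by
    simp [signComm, h0, (X.covariant_Y b).apply_vacuum hk]) N).2 (m - N)
  rw [hN] at h1
  simpa [signComm, h0, X.creation] using h1.symm

/-- Goddard's uniqueness theorem. -/
theorem Covariant.eq_Y {F : ℤ → End ℂ V} (hF : X.Covariant F) {p : ZMod 2} {a : V}
    (ha : X.Γ a = paritySign p • a) (h : F (-1) X.Ω = a)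
    (hloc : ∀ (q : ZMod 2) (b : V), X.Γ b = paritySign q • b →
      SignLocal (paritySign (p * q)) F (X.Y b)) : F = X.Y a := by
  rw [← sub_eq_zero]
  refine (hF.sub (X.covariant_Y a)).eq_zero ?_ fun q b hb => ⟨_, (hloc q b hb).sub
    (X.signLocal_Y ha hb)⟩
  rw [Pi.sub_apply, LinearMap.sub_apply, h, X.creation, sub_self]

variable (X)

/-- The coefficients of `(z - w)^n (Y(a, z) Y(b, w) - ε Y(b, w) Y(a, z))`. -/
def comm (ε : ℂ) (a b : V) (n : ℕ) : ℤ → ℤ → End ℂ V :=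
  (zSubW (End ℂ V) ^ n) (signComm ε (X.Y a) (X.Y b))

theorem comm_zero (ε : ℂ) (a b : V) (p q : ℤ) :
    X.comm ε a b 0 p q = X.Y a p * X.Y b q - ε • (X.Y b q * X.Y a p) := rfl

theorem comm_succ (ε : ℂ) (a b : V) (n : ℕ) (p q : ℤ) :
    X.comm ε a b (n + 1) p q = X.comm ε a b n (p + 1) q - X.comm ε a b n p (q + 1) :=
  zSubW_pow_succ_apply _ _ _ _

theorem T_comm (ε : ℂ) (a b : V) (n : ℕ) (p q : ℤ) :
    X.T * X.comm ε a b n p q - X.comm ε a b n p q * X.T =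
      -(p : ℂ) • X.comm ε a b n (p - 1) q - (q : ℂ) • X.comm ε a b n p (q - 1) := by
  induction n generalizing p q with
  | zero =>
    have h1 := X.translation a p
    have h2 := X.translation b q
    simp only [comm_zero]
    have h3 : X.T * X.Y a p = X.Y a p * X.T + -(p : ℂ) • X.Y a (p - 1) :=
      sub_eq_iff_eq_add'.mp h1
    have h4 : X.T * X.Y b q = X.Y b q * X.T + -(q : ℂ) • X.Y b (q - 1) :=
      sub_eq_iff_eq_add'.mp h2
    have e1 : X.T * (X.Y a p * X.Y b q) = X.Y a p * X.Y b q * X.T +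
        -(q : ℂ) • (X.Y a p * X.Y b (q - 1)) + -(p : ℂ) • (X.Y a (p - 1) * X.Y b q) := by
      rw [← mul_assoc, h3, add_mul, mul_assoc, h4, mul_add, smul_mul_assoc, mul_smul_comm, mul_assoc]
    have e2 : X.T * (X.Y b q * X.Y a p) = X.Y b q * X.Y a p * X.T +
        -(p : ℂ) • (X.Y b q * X.Y a (p - 1)) + -(q : ℂ) • (X.Y b (q - 1) * X.Y a p) := by
      rw [← mul_assoc, h4, add_mul, mul_assoc, h3, mul_add, smul_mul_assoc, mul_smul_comm, mul_assoc]
    rw [mul_sub, sub_mul, mul_smul_comm, smul_mul_assoc, e1, e2]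
    module
  | succ n ih =>
    simp only [comm_succ, mul_sub, sub_mul]
    have h1 := ih (p + 1) q
    have h2 := ih p (q + 1)
    rw [add_sub_cancel_right] at h1 h2
    rw [sub_sub_sub_comm, h1, h2]
    rw [show p - 1 + 1 = p by ring, show q - 1 + 1 = q by ring]
    push_cast
    module

/-- The coefficients of `∑_l Y(a_(n+l) b, w) ∂_w^l δ(z - w) / l!`. -/
noncomputable def productSum (a b : V) (N n : ℕ) (p q : ℤ) : End ℂ V :=
  ∑ l ∈ Finset.range (N + 1), (Ring.choose p l : ℂ) • X.Y (X.Y a (n + l) b) (p + q - l)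

/-- Pascal's rule. The top summand on the right vanishes by `hN`, so the same truncation serves `n`
and `n + 1`. -/
theorem productSum_succ {a b : V} {N : ℕ} (hN : ∀ j : ℤ, (N : ℤ) ≤ j → X.Y a j b = 0)
    (n : ℕ) (p q : ℤ) :
    X.productSum a b N n (p + 1) q - X.productSum a b N n p (q + 1) =
      X.productSum a b N (n + 1) p q := by
  simp only [productSum]
  rw [← Finset.sum_sub_distrib, Finset.sum_range_succ', Finset.sum_range_succ _ N]
  rw [hN ((n + 1 : ℕ) + (N : ℤ)) (by push_cast; omega)]
  simp only [map_zero, Pi.zero_apply, smul_zero, add_zero, Nat.cast_zero, Ring.choose_zero_right,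
    sub_zero]
  rw [show p + 1 + q = p + (q + 1) by ring, sub_self, add_zero]
  refine Finset.sum_congr rfl fun l _ => ?_
  rw [← sub_smul]
  push_cast
  rw [Ring.choose_succ_succ, add_sub_cancel_right,
    show (n : ℤ) + (l + 1) = n + 1 + l by ring, show p + (q + 1) - ((l : ℤ) + 1) = p + q - l by ring]

theorem productSum_zero (a b : V) (N n : ℕ) (q : ℤ) :
    X.productSum a b N n 0 q = X.Y (X.Y a n b) q := by
  rw [productSum, Finset.sum_range_succ']
  simp [Ring.choose_zero_succ]

/-- Borcherds' commutator formula: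
`(z - w)^n [Y(a, z), Y(b, w)] = ∑_l Y(a_(n+l) b, w) ∂_w^l δ(z - w) / l!` for `n ≥ 0`. -/
theorem comm_eq_productSum {s t : ZMod 2} {a b : V} (ha : X.Γ a = paritySign s • a)
    (hb : X.Γ b = paritySign t • b) {N : ℕ} (hN : ∀ j : ℤ, (N : ℤ) ≤ j → X.Y a j b = 0)
    (n : ℕ) (p q : ℤ) :
    X.comm (paritySign (s * t)) a b n p q = X.productSum a b N n p q := by
  obtain ⟨K, hK⟩ := mem_nil.mp (X.signLocal_Y ha hb)
  have hX : ∀ n, K ≤ n → X.comm (paritySign (s * t)) a b n = 0 := by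
    intro n hn
    obtain ⟨j, rfl⟩ := Nat.exists_eq_add_of_le' hn
    rw [comm, pow_add, End.mul_apply, hK, map_zero]
  -- Descending induction on `n`: both sides vanish for `n ≥ max K N`, and `j` bounds the distance
  -- to that range.
  have key : ∀ j n : ℕ, max K N ≤ n + j →
      X.comm (paritySign (s * t)) a b n = X.productSum a b N n := by
    intro j
    induction j with
    | zero =>
      intro n hn
      rw [hX n (by omega)]
      funext p q
      symm
      exact Finset.sum_eq_zero fun l _ => by
        rw [hN _ (by omega)]
        simp
    | succ j ih =>
      intro n hn
      have ih' := ih (n + 1) (by omega)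
      set D : ℤ → ℤ → End ℂ V := X.comm (paritySign (s * t)) a b n - X.productSum a b N n with hD
      -- By the case `n + 1`, the difference `D` is annihilated by `z - w`; hence `D(z, w) = E(w)
      -- δ(z - w)`.
      have hstep : ∀ p q, D (p + 1) q = D p (q + 1) := by
        intro p q
        have := congr_fun (congr_fun ih' p) q
        rw [comm_succ, ← X.productSum_succ hN] at this
        simp only [hD, Pi.sub_apply]
        rw [sub_eq_sub_iff_sub_eq_sub, this]
      set E : ℤ → End ℂ V := D 0 with hE
      have hDE : ∀ p q, D p q = E (p + q) := by
        intro p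
        induction p with
        | zero => simp [hE]
        | succ i ih =>
          intro q
          rw [hstep, ih]
          congr 1
          ring
        | pred i ih =>
          intro q
          have := hstep (-i - 1) (q - 1)
          rw [sub_add_cancel, sub_add_cancel, ih] at this
          rw [← this]
          congr 1
          ring
      have hEval : ∀ q, E q = X.comm (paritySign (s * t)) a b n 0 q - X.Y (X.Y a n b) q := by
        intro q
        rw [← productSum_zero X a b N n q]
        rfl
      have hvac : ∀ (n : ℕ) (p q : ℤ), 0 ≤ p → 0 ≤ q →
          X.comm (paritySign (s * t)) a b n p q X.Ω = 0 := by
        intro n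
        induction n with
        | zero =>
          intro p q hp hq
          simp [comm_zero, (X.covariant_Y a).apply_vacuum hp, (X.covariant_Y b).apply_vacuum hq]
        | succ n ih =>
          intro p q hp hq
          rw [comm_succ, LinearMap.sub_apply, ih _ _ (by omega) hq, ih _ _ hp (by omega), sub_zero]
      have hvac' : ∀ (n : ℕ) (p : ℤ), 0 ≤ p →
          X.comm (paritySign (s * t)) a b n p (-1) X.Ω = X.Y a (p + n) b := by
        intro n
        induction n with
        | zero =>
          intro p hp
          simp [comm_zero, (X.covariant_Y a).apply_vacuum hp, X.creation]
        | succ n ih =>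
          intro p hp
          rw [comm_succ, LinearMap.sub_apply, ih _ (by omega), neg_add_cancel,
            hvac _ _ _ hp le_rfl, sub_zero]
          push_cast
          rw [show p + 1 + (n : ℤ) = p + (n + 1) by ring]
      have hcov : X.Covariant E := by
        refine ⟨fun q => ?_, 0, fun q hq => ?_⟩
        · have h1 := X.T_comm (paritySign (s * t)) a b n 0 q
          have h2 := X.translation (X.Y a n b) q
          rw [hEval, hEval, mul_sub, sub_mul, sub_sub_sub_comm, h1, h2]
          simp only [Int.cast_zero, neg_zero, zero_smul, zero_sub]
          module
        · rw [hEval, LinearMap.sub_apply, hvac _ _ _ le_rfl (by simpa using hq),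
            (X.covariant_Y _).apply_vacuum (by simpa using hq), sub_zero]
      -- Goddard's theorem kills `E`: its coefficient `-1` vanishes on `Ω` by `hvac'`, and Dong's
      -- lemma gives locality of `E(w) δ(z - w)`, hence of `E`.
      have hE0 : E = 0 := by
        refine hcov.eq_zero ?_ fun r c hc => ?_
        · rw [hEval, LinearMap.sub_apply, hvac' _ _ le_rfl, X.creation, zero_add, sub_self]
        · refine ⟨paritySign (s * r) * paritySign (t * r), mem_nil_of_diagonal ?_⟩
          have h1 := signComm_signComm_mem_nil (α := paritySign (s * t))
            (X.signLocal_Y ha hc) (X.signLocal_Y hb hc) n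
          have hl : ∀ l : ℕ, (fun p q m : ℤ => (Ring.choose p l : ℂ) •
              signComm (paritySign (s * r) * paritySign (t * r))
                (X.Y (X.Y a (n + l) b)) (X.Y c) (p + q - l) m) ∈
              nil (wSubX₃ (End ℂ V) * zSubX₃ (End ℂ V)) := by
            intro l
            refine mem_nil_mul_right (commute_wSubX_zSubX _) ?_
            have hloc := X.signLocal_Y (X.parity_preserving s t a b (n + l) ha hb) hc
            rw [add_mul, paritySign_add] at hloc
            let φ : (ℤ → ℤ → End ℂ V) →ₗ[ℂ] (ℤ → ℤ → ℤ → End ℂ V) :=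
              { toFun := fun D p q m => (Ring.choose p l : ℂ) • D (p + q - l) m
                map_add' := fun D E => by
                  funext p q m
                  simp [smul_add]
                map_smul' := fun c D => by
                  funext p q m
                  simp only [Pi.smul_apply, RingHom.id_apply]
                  rw [smul_comm] }
            refine map_mem_nil φ (fun D => ?_) hloc
            funext p q m
            simp only [φ, zSubW, wSubX₃, LinearMap.coe_mk, AddHom.coe_mk, smul_sub]
            rw [show p + q - (l : ℤ) + 1 = p + (q + 1) - l by ring]
          have h2 := sub_mem h1 (Submodule.sum_mem _ (t := Finset.range (N + 1)) fun l _ => hl l)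
          convert h2 using 1
          funext p q m
          have h3 := hDE p q
          simp only [signComm, Pi.sub_apply, Finset.sum_apply]
          rw [← h3, hD]
          simp only [Pi.sub_apply, productSum, sub_mul, mul_sub, Finset.sum_mul, Finset.mul_sum,
            smul_sub, Finset.smul_sum, Finset.sum_sub_distrib, smul_mul_assoc, mul_smul_comm, comm]
          simp only [smul_comm (Ring.choose _ _ : ℂ)]
          abel
      have hD0 : D = 0 := by
        funext p q
        rw [hDE, hE0]
        rfl
      exact sub_eq_zero.mp hD0
  exact congr_fun (congr_fun (key (max K N) n (by omega)) p) q

end VertexSuperalgebra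

end VertexSuper

/-! ### Signs, weights and commutators with `L_{-1}`, `L_0`, `L_1` -/

namespace VertexSuper

open Module

theorem paritySign_intCast (k : ℤ) : paritySign (k : ZMod 2) = (-1 : ℂ) ^ k := by
  rcases Int.even_or_odd k with h | h
  · rw [h.neg_one_zpow, paritySign, if_pos ((ZMod.intCast_zmod_eq_zero_iff_dvd k 2).mpr h.two_dvd)]
  · have : (k : ZMod 2) ≠ 0 := fun h0 => by
      have := (ZMod.intCast_zmod_eq_zero_iff_dvd k 2).mp h0
      rw [Int.odd_iff] at h
      omega
    rw [h.neg_one_zpow, paritySign, if_neg this]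

theorem neg_one_zpow_mul_self (k : ℤ) : (-1 : ℂ) ^ k * (-1 : ℂ) ^ k = 1 := by
  rw [← mul_zpow]
  simp

theorem choose_succ_mul (r : ℂ) (i : ℕ) :
    ((i : ℂ) + 1) * Ring.choose r (i + 1) = (r - i) * Ring.choose r i := by
  have := Ring.choose_smul_choose r (Nat.le_succ i)
  simpa [Ring.choose_one_right, mul_comm] using this

namespace VOSA

theorem weightSign_mul_self (k : ℤ) : weightSign k * weightSign k = 1 := neg_one_zpow_mul_self _

theorem weightSign_sub_two (k : ℤ) : weightSign (k - 2) = -weightSign k := by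
  have : k * (k + 1) / 2 = (k - 2) * (k - 2 + 1) / 2 + (2 * k - 1) := by
    rw [show k * (k + 1) = (k - 2) * (k - 2 + 1) + (2 * k - 1) * 2 by ring,
      Int.add_mul_ediv_right _ _ two_ne_zero]
  have h : Odd (2 * k - 1) := ⟨k - 1, by ring⟩
  rw [weightSign, weightSign, this, zpow_add₀ (by norm_num), h.neg_one_zpow]
  ring

/-- The cross term of the quadratic exponent is `k l`, giving the sign with which fields of weights
`k / 2` and `l / 2` commute; this makes the sign compatible with adjoints of commutators. -/
theorem weightSign_add (k l : ℤ) :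
    weightSign (k + l) = weightSign k * weightSign l * (-1 : ℂ) ^ (k * l) := by
  have : (k + l) * (k + l + 1) / 2 = k * (k + 1) / 2 + l * (l + 1) / 2 + k * l := by
    have h1 := Int.even_mul_succ_self k
    have h2 := Int.even_mul_succ_self l
    obtain ⟨x, hx⟩ := h1
    obtain ⟨y, hy⟩ := h2
    rw [show (k + l) * (k + l + 1) = k * (k + 1) + l * (l + 1) + 2 * (k * l) by ring, hx, hy]
    omega
  rw [weightSign, weightSign, weightSign, this, zpow_add₀ (by norm_num), zpow_add₀ (by norm_num)]

theorem weightSign_sub_two_mul (k : ℤ) (n : ℕ) :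
    weightSign (k - 2 * n) = (-1) ^ n * weightSign k := by
  induction n with
  | zero => simp
  | succ n ih =>
    rw [show k - 2 * ((n + 1 : ℕ) : ℤ) = k - 2 * n - 2 by push_cast; ring, weightSign_sub_two, ih]
    ring

theorem star_weightSign (k : ℤ) : (starRingEnd ℂ) (weightSign k) = weightSign k := by
  simp [weightSign]

variable {V : Type*} [AddCommGroup V] [Module ℂ V] (X : VOSA V)

theorem W_induction {P : V → Prop} (h : ∀ (k : ℤ) (a : V), a ∈ X.W k → P a)
    (hadd : ∀ a b, P a → P b → P (a + b)) (a : V) : P a := by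
  have ha : a ∈ ⨆ k, X.W k := by
    rw [((DirectSum.isInternal_submodule_iff_iSupIndep_and_iSup_eq_top _).mp X.isInternal_W).2]
    trivial
  exact Submodule.iSup_induction _ (motive := P) ha h (h 0 0 (zero_mem _)) hadd

theorem mem_W {k : ℤ} {a : V} : a ∈ X.W k ↔ X.L 0 a = ((k : ℂ) / 2) • a := End.mem_eigenspace_iff

theorem L_zero_eq : X.L 0 = X.Y X.ν 1 := by simp [L]

theorem L_neg_one_eq : X.L (-1) = X.T := by simp [L, X.L_neg_one]

theorem parity_of_mem_W {k : ℤ} {a : V} (ha : a ∈ X.W k) :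
    X.Γ a = paritySign (k : ZMod 2) • a := by
  rw [paritySign_intCast]
  rcases Int.even_or_odd' k with ⟨n, rfl | rfl⟩
  · have h1 : a ∈ End.eigenspace X.Γ 1 := by
      rw [X.even_part]
      refine Submodule.mem_iSup_of_mem n ?_
      rw [W, L_zero_eq] at ha
      convert ha using 2
      push_cast
      ring
    rw [End.mem_eigenspace_iff.mp h1, (even_two_mul n).neg_one_zpow]
  · have h1 : a ∈ End.eigenspace X.Γ (-1) := by
      rw [X.odd_part]
      refine Submodule.mem_iSup_of_mem (n + 1) ?_
      rw [W, L_zero_eq] at ha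
      convert ha using 2
      push_cast
      ring
    rw [End.mem_eigenspace_iff.mp h1, (odd_two_mul_add_one n).neg_one_zpow]

theorem parity_mul (k l : ℤ) : paritySign ((k : ZMod 2) * (l : ZMod 2)) = (-1 : ℂ) ^ (k * l) := by
  rw [← paritySign_intCast]
  push_cast
  rfl

/-- The commutator formula for the modes of the conformal vector. -/
theorem Y_ν_comm (p : ℕ) (a : V) (q : ℤ) :
    X.Y X.ν p * X.Y a q - X.Y a q * X.Y X.ν p =
      ∑ l ∈ Finset.range (p + 1), (p.choose l : ℂ) • X.Y (X.Y X.ν l a) (p + q - l) := by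
  refine X.parity_induction (P := fun a => X.Y X.ν p * X.Y a q - X.Y a q * X.Y X.ν p =
      ∑ l ∈ Finset.range (p + 1), (p.choose l : ℂ) • X.Y (X.Y X.ν l a) (p + q - l))
    (fun t a ha => ?_) (fun a b ha hb => ?_) a
  · obtain ⟨N, hN⟩ := X.field X.ν a
    have hν : X.Γ X.ν = paritySign 0 • X.ν := by simp [X.conformal_even, paritySign]
    -- The cutoff `max N p` makes the range contain all `l ≤ p`; beyond `p` the binomial
    -- coefficients vanish.
    have h := X.comm_eq_productSum hν ha (N := max N p)
      (fun j hj => hN j (le_trans (by exact_mod_cast le_max_left _ _) hj)) 0 p q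
    rw [X.comm_zero, zero_mul] at h
    simp only [paritySign, if_true, one_smul] at h
    rw [h, VertexSuperalgebra.productSum]
    symm
    refine Finset.sum_subset_zero_on_sdiff
      (Finset.range_subset_range.mpr (by omega)) (fun l hl => ?_) (fun l hl => ?_)
    · simp only [Finset.mem_sdiff, Finset.mem_range] at hl
      rw [Int.cast_natCast, Ring.choose_natCast, Nat.choose_eq_zero_of_lt (by omega)]
      simp
    · rw [Int.cast_natCast, Ring.choose_natCast]
      simp
  · rw [map_add, Pi.add_apply, mul_add, add_mul, add_sub_add_comm, ha, hb,
      ← Finset.sum_add_distrib]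
    refine Finset.sum_congr rfl fun l _ => ?_
    rw [map_add, map_add, Pi.add_apply, smul_add]

theorem T_comm_Y (a : V) (q : ℤ) : X.T * X.Y a q - X.Y a q * X.T = X.Y (X.T a) q := by
  have := X.Y_ν_comm 0 a q
  simpa [X.L_neg_one] using this

theorem Y_T (a : V) (q : ℤ) : X.Y (X.T a) q = -(q : ℂ) • X.Y a (q - 1) := by
  rw [← T_comm_Y, X.translation]

theorem L_zero_comm_Y (a : V) (q : ℤ) :
    X.L 0 * X.Y a q - X.Y a q * X.L 0 = X.Y (X.T a) (q + 1) + X.Y (X.L 0 a) q := by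
  have := X.Y_ν_comm 1 a q
  rw [L_zero_eq]
  simpa [Finset.sum_range_succ, X.L_neg_one, add_comm (1 : ℤ)] using this

theorem L_one_comm_Y (a : V) (q : ℤ) :
    X.L 1 * X.Y a q - X.Y a q * X.L 1 =
      X.Y (X.T a) (q + 2) + (2 : ℂ) • X.Y (X.L 0 a) (q + 1) + X.Y (X.L 1 a) q := by
  have := X.Y_ν_comm 2 a q
  have h1 : X.L 1 = X.Y X.ν 2 := by simp [L]
  rw [L_zero_eq, h1]
  rw [show (2 : ℤ) = ((2 : ℕ) : ℤ) by rfl, this]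
  simp only [Finset.sum_range_succ, Finset.range_zero, Finset.sum_empty]
  norm_num [X.L_neg_one]
  rw [show 2 + q - 1 = q + 1 by ring, add_comm 2 q]

theorem Y_mem_W {k l : ℤ} {a b : V} (ha : a ∈ X.W k) (hb : b ∈ X.W l) (n : ℤ) :
    X.Y a n b ∈ X.W (k + l - 2 * n - 2) := by
  rw [mem_W] at *
  have h := LinearMap.congr_fun (X.L_zero_comm_Y a n) b
  rw [Y_T, ha, add_sub_cancel_right, map_smul] at h
  simp only [LinearMap.sub_apply, End.mul_apply, hb, map_smul, LinearMap.add_apply,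
    LinearMap.smul_apply, Pi.smul_apply] at h
  rw [sub_eq_iff_eq_add.mp h]
  push_cast
  module

theorem vacuum_apply {n : ℤ} (a : V) (hn : 0 ≤ n) : X.Y a n X.Ω = 0 :=
  (X.covariant_Y a).apply_vacuum hn

theorem vacuum_mem_W : X.Ω ∈ X.W 0 := by
  rw [mem_W, L_zero_eq, X.vacuum_apply _ (by norm_num)]
  simp

theorem L_one_vacuum : X.L 1 X.Ω = 0 := X.vacuum_apply _ (by norm_num)

/-- In the cases allowed by `h` there is no central term: `n^3 - n` has the roots `-1`, `0`, `1`. -/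
theorem L_comm (n m : ℤ) (h : n + m ≠ 0 ∨ n = 1 ∨ n = -1 ∨ n = 0) (a : V) :
    X.L n (X.L m a) = X.L m (X.L n a) + ((n : ℂ) - m) • X.L (n + m) a := by
  obtain ⟨c, hc⟩ := X.virasoro
  have h0 : (if n = -m then c * ((n : ℂ) ^ 3 - n) / 12 else 0) = 0 := by
    split_ifs with h1
    · rcases h with h | h | h | h
      · omega
      all_goals
        rw [h]
        norm_num
    · rfl
  have h1 := LinearMap.congr_fun (hc n m) a
  rw [h0, zero_smul, add_zero] at h1
  exact sub_eq_iff_eq_add'.mp h1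

theorem L_zero_T (a : V) : X.L 0 (X.T a) = X.T (X.L 0 a) + X.T a := by
  have := X.L_comm 0 (-1) (by simp) a
  simpa [L_neg_one_eq] using this

theorem L_one_T (a : V) : X.L 1 (X.T a) = X.T (X.L 1 a) + (2 : ℂ) • X.L 0 a := by
  have := X.L_comm 1 (-1) (by simp) a
  norm_num [L_neg_one_eq] at this
  exact this

theorem L_one_L_zero (a : V) : X.L 1 (X.L 0 a) = X.L 0 (X.L 1 a) + X.L 1 a := by
  have := X.L_comm 1 0 (by simp) a
  simpa using this

theorem T_mem_W {k : ℤ} {a : V} (ha : a ∈ X.W k) : X.T a ∈ X.W (k + 2) := by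
  rw [mem_W] at *
  rw [L_zero_T, ha, map_smul]
  push_cast
  module

theorem L_neg_two_vacuum : X.L (-2) X.Ω = X.ν := by
  simp [L, X.creation]

theorem L_zero_vacuum : X.L 0 X.Ω = 0 := by
  have := X.vacuum_mem_W
  rw [mem_W] at this
  simpa using this

theorem conformal_mem_W : X.ν ∈ X.W 4 := by
  have := X.L_comm 0 (-2) (by simp) X.Ω
  rw [L_zero_vacuum, map_zero, zero_add, zero_add, L_neg_two_vacuum] at this
  rw [mem_W, this]
  norm_num

theorem L_one_conformal : X.L 1 X.ν = 0 := by
  have := X.L_comm 1 (-2) (by simp) X.Ω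
  rw [L_one_vacuum, map_zero, zero_add, L_neg_two_vacuum] at this
  rw [this]
  norm_num [L_neg_one_eq, X.T_vacuum]

/-! ### Half-integer modes, indexed by twice the degree -/

section Modes

theorem mode_eq {h k n : ℤ} {a : V} (ha : a ∈ X.W k) (hn : h + k = 2 * (n + 1)) :
    X.mode h a = X.Y a n := by
  rw [X.mode_of_even ha (hn ▸ even_two_mul _), hn, show 2 * (n + 1) / 2 - 1 = n by omega]

theorem Y_eq_mode {k : ℤ} {a : V} (ha : a ∈ X.W k) (n : ℤ) :
    X.Y a n = X.mode (2 * (n + 1) - k) a := (X.mode_eq ha (by ring)).symm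

theorem mode_conformal (n : ℤ) : X.mode (2 * n) X.ν = X.L n :=
  X.mode_eq X.conformal_mem_W (by ring)

/-- The combination `T + L_0` acts on modes by a scalar that does not involve the weight of `a`, and
therefore passes through adjunction. -/
theorem mode_T_add (h : ℤ) (a : V) :
    X.mode h (X.T a + X.L 0 a) = -((h : ℂ) / 2) • X.mode h a := by
  refine X.W_induction (P := fun a => X.mode h (X.T a + X.L 0 a) = -((h : ℂ) / 2) • X.mode h a)
    (fun k a ha => ?_) (fun a b ha hb => ?_) a
  · rw [map_add, X.mem_W.mp ha, map_smul]
    by_cases hk : Even (h + k)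
    · obtain ⟨n, hn⟩ := hk
      rw [X.mode_eq (n := n) (X.T_mem_W ha) (by omega), X.mode_eq (n := n - 1) ha (by omega), Y_T]
      have hn' : (h : ℂ) + k = n + n := by exact_mod_cast hn
      rw [← add_smul]
      congr 1
      linear_combination hn' / 2
    · rw [X.mode_of_not_even ha hk, X.mode_of_not_even (X.T_mem_W ha)
        (by rwa [← add_assoc, Int.even_add, iff_true_right (by decide)])]
      simp
  · simp only [map_add, smul_add] at *
    rw [← ha, ← hb]
    abel

theorem T_comm_mode (h : ℤ) (a : V) :
    X.T * X.mode h a - X.mode h a * X.T = X.mode (h - 2) (X.T a) := by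
  refine X.W_induction
    (P := fun a => X.T * X.mode h a - X.mode h a * X.T = X.mode (h - 2) (X.T a))
    (fun k a ha => ?_) (fun a b ha hb => ?_) a
  · by_cases hk : Even (h + k)
    · obtain ⟨n, hn⟩ := hk
      rw [X.mode_eq (n := n - 1) (X.T_mem_W ha) (by omega), X.mode_eq (n := n - 1) ha (by omega),
        T_comm_Y]
    · rw [X.mode_of_not_even ha hk, X.mode_of_not_even (X.T_mem_W ha) (by
        rwa [show h - 2 + (k + 2) = h + k by ring])]
      simp
  · simp only [map_add, mul_add, add_mul] at *
    rw [← ha, ← hb]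
    abel

theorem L_one_comm_mode (h : ℤ) (a : V) :
    X.L 1 * X.mode h a - X.mode h a * X.L 1 =
      X.mode (h + 2) (X.T a + (2 : ℂ) • X.L 0 a + X.L 1 a) := by
  refine X.W_induction (P := fun a => X.L 1 * X.mode h a - X.mode h a * X.L 1 =
      X.mode (h + 2) (X.T a + (2 : ℂ) • X.L 0 a + X.L 1 a))
    (fun k a ha => ?_) (fun a b ha hb => ?_) a
  · have h0 : X.L 0 a ∈ X.W k := by
      rw [X.mem_W.mp ha]
      exact Submodule.smul_mem _ _ ha
    rw [map_add, map_add, map_smul]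
    by_cases hk : Even (h + k)
    · obtain ⟨n, hn⟩ := hk
      rw [X.mode_eq (n := n + 1) (X.T_mem_W ha) (by omega), X.mode_eq (n := n - 1) ha (by omega),
        X.mode_eq (n := n) h0 (by omega), X.mode_eq (n := n - 1) (X.L_one_mem_W ha) (by omega),
        L_one_comm_Y, sub_add_cancel, show n - 1 + 2 = n + 1 by ring]
    · have h2 : Even (2 : ℤ) := by decide
      rw [X.mode_of_not_even ha hk, X.mode_of_not_even (X.T_mem_W ha) (by
        rwa [show h + 2 + (k + 2) = h + k + 2 + 2 by ring, Int.even_add, iff_true_right h2,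
          Int.even_add, iff_true_right h2]), X.mode_of_not_even h0 (by
        rwa [show h + 2 + k = h + k + 2 by ring, Int.even_add, iff_true_right h2]),
        X.mode_of_not_even (X.L_one_mem_W ha) (by
        rwa [show h + 2 + (k - 2) = h + k by ring])]
      simp
  · simp only [map_add, mul_add, add_mul, smul_add] at *
    rw [add_sub_add_comm, ha, hb]
    abel

/-- Let `k / 2` be the lowest weight occurring in `y`. The mode of degree `-k / 2` applied to `Ω`
returns that component by creation; a higher component contributes either no mode or some `a_(n) Ω =
0` with `n ≥ 0`. -/
theorem eq_zero_of_mode_eq_zero {y : V} (hy : ∀ h, X.mode h y = 0) : y = 0 := by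
  classical
  by_contra hne
  set f := X.decomp y with hf
  have hf0 : f ≠ 0 := by
    rw [hf, ne_eq, LinearEquiv.map_eq_zero_iff]
    exact hne
  have hsum : y = ∑ k ∈ f.support, (f k : V) := by
    have h1 : X.decomp.symm f = y := X.decomp.symm_apply_apply y
    rw [← h1]
    exact DirectSum.coeLinearMap_eq_dfinsuppSum X.W f
  have hs : f.support.Nonempty := by
    rw [Finset.nonempty_iff_ne_empty, ne_eq, DFinsupp.support_eq_empty]
    exact hf0
  set k := f.support.min' hs
  have hk : k ∈ f.support := f.support.min'_mem hs
  have h1 := LinearMap.congr_fun (hy (-k)) X.Ω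
  rw [hsum, map_sum, LinearMap.sum_apply, Finset.sum_eq_single_of_mem k hk] at h1
  · rw [X.mode_eq (n := -1) (f k).2 (by ring), X.creation] at h1
    rw [DFinsupp.mem_support_iff] at hk
    exact hk (Subtype.ext h1)
  · intro l hl hlk
    have hkl : k < l := lt_of_le_of_ne (f.support.min'_le l hl) (Ne.symm hlk)
    by_cases he : Even (-k + l)
    · obtain ⟨n, hn⟩ := he
      rw [X.mode_eq (n := n - 1) (f l).2 (by omega), X.vacuum_apply _ (by omega)]
    · rw [X.mode_of_not_even (f l).2 he, LinearMap.zero_apply]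

theorem eq_of_mode_eq {x y : V} (h : ∀ n, X.mode n x = X.mode n y) : x = y :=
  sub_eq_zero.mp (X.eq_zero_of_mode_eq_zero fun n => by rw [map_sub, h, sub_self])

end Modes

end VOSA

end VertexSuper

/-! ### The involution `e^{L_1} (-1)^{2 L_0^2 + L_0}` -/

namespace VertexSuper

open Module

namespace VOSA

variable {V : Type*} [AddCommGroup V] [Module ℂ V] (X : VOSA V)

section SignOp

theorem signOp_signOp (a : V) : X.signOp (X.signOp a) = a := by
  refine X.W_induction (P := fun a => X.signOp (X.signOp a) = a) (fun k a ha => ?_)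
    (fun a b ha hb => by simp only [map_add, ha, hb]) a
  rw [X.signOp_of_mem ha, map_smul, X.signOp_of_mem ha, smul_smul, weightSign_mul_self, one_smul]

theorem signOp_mem_W {k : ℤ} {a : V} (ha : a ∈ X.W k) : X.signOp a ∈ X.W k := by
  rw [X.signOp_of_mem ha]
  exact Submodule.smul_mem _ _ ha

theorem signOp_L_one (a : V) : X.signOp (X.L 1 a) = -X.L 1 (X.signOp a) := by
  refine X.W_induction (P := fun a => X.signOp (X.L 1 a) = -X.L 1 (X.signOp a))
    (fun k a ha => ?_) (fun a b ha hb => by simp only [map_add, ha, hb, neg_add]) a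
  rw [X.signOp_of_mem ha, X.signOp_of_mem (X.L_one_mem_W ha), weightSign_sub_two, map_smul,
    neg_smul]

theorem signOp_L_zero (a : V) : X.signOp (X.L 0 a) = X.L 0 (X.signOp a) := by
  refine X.W_induction (P := fun a => X.signOp (X.L 0 a) = X.L 0 (X.signOp a))
    (fun k a ha => ?_) (fun a b ha hb => by simp only [map_add, ha, hb]) a
  rw [X.mem_W.mp ha, map_smul, X.mem_W.mp (X.signOp_mem_W ha)]

theorem signOp_T (a : V) : X.signOp (X.T a) = -X.T (X.signOp a) := by
  refine X.W_induction (P := fun a => X.signOp (X.T a) = -X.T (X.signOp a))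
    (fun k a ha => ?_) (fun a b ha hb => by simp only [map_add, ha, hb, neg_add]) a
  have h := weightSign_sub_two (k + 2)
  rw [add_sub_cancel_right] at h
  rw [X.signOp_of_mem ha, X.signOp_of_mem (X.T_mem_W ha), map_smul, h, neg_smul, neg_neg]

theorem signOp_L_one_pow (l : ℕ) (a : V) :
    X.signOp ((X.L 1 ^ l) a) = (-1 : ℂ) ^ l • (X.L 1 ^ l) (X.signOp a) := by
  induction l with
  | zero => simp
  | succ l ih =>
    rw [pow_succ', End.mul_apply, signOp_L_one, ih, map_smul, End.mul_apply, pow_succ]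
    module

end SignOp

section ExpLOne

theorem expLOne_eq_sum {a : V} {N : ℕ} (hN : ∀ l, N ≤ l → (X.L 1 ^ l) a = 0) :
    X.expLOne a = ∑ l ∈ Finset.range N, (1 / (l.factorial : ℂ)) • (X.L 1 ^ l) a := by
  refine finsum_eq_sum_of_support_subset _ fun l hl => ?_
  by_contra h
  simp only [Finset.coe_range, Set.mem_Iio, not_lt] at h
  exact hl (by simp [hN l h])

theorem expLOne_add (a b : V) : X.expLOne (a + b) = X.expLOne a + X.expLOne b := by
  obtain ⟨N, hN⟩ := X.exists_L_one_pow_eq_zero a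
  obtain ⟨M, hM⟩ := X.exists_L_one_pow_eq_zero b
  have h1 : ∀ l, max N M ≤ l → (X.L 1 ^ l) a = 0 := fun l hl => hN l (by omega)
  have h2 : ∀ l, max N M ≤ l → (X.L 1 ^ l) b = 0 := fun l hl => hM l (by omega)
  rw [X.expLOne_eq_sum h1, X.expLOne_eq_sum h2,
    X.expLOne_eq_sum (N := max N M) fun l hl => by rw [map_add, h1 l hl, h2 l hl, add_zero],
    ← Finset.sum_add_distrib]
  simp only [map_add, smul_add]

theorem expLOne_smul (c : ℂ) (a : V) : X.expLOne (c • a) = c • X.expLOne a := by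
  obtain ⟨N, hN⟩ := X.exists_L_one_pow_eq_zero a
  rw [X.expLOne_eq_sum hN, X.expLOne_eq_sum (N := N) fun l hl => by
    rw [map_smul, hN l hl, smul_zero], Finset.smul_sum]
  refine Finset.sum_congr rfl fun l _ => ?_
  rw [map_smul, smul_comm]

/-- The linear operator `e^{L_1}`. -/
noncomputable def expL : End ℂ V where
  toFun := X.expLOne
  map_add' := X.expLOne_add
  map_smul' := X.expLOne_smul

theorem expL_apply (a : V) : X.expL a = X.expLOne a := rfl

theorem expL_eq_self {a : V} (h : X.L 1 a = 0) : X.expL a = a := by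
  rw [expL_apply, X.expLOne_eq_sum (N := 1)]
  · simp
  · intro l hl
    obtain ⟨j, rfl⟩ := Nat.exists_eq_add_of_le' hl
    rw [pow_succ, End.mul_apply, h, map_zero]

theorem L_one_expL {a : V} {N : ℕ} (hN : ∀ l, N ≤ l → (X.L 1 ^ l) a = 0) :
    X.L 1 (X.expL a) = ∑ l ∈ Finset.range N, ((l : ℂ) / (l.factorial : ℂ)) • (X.L 1 ^ l) a := by
  have h1 : ∀ N, X.L 1 (∑ l ∈ Finset.range N, (1 / (l.factorial : ℂ)) • (X.L 1 ^ l) a) =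
      ∑ l ∈ Finset.range (N + 1), ((l : ℂ) / (l.factorial : ℂ)) • (X.L 1 ^ l) a := by
    intro N
    rw [Finset.sum_range_succ', map_sum]
    simp only [Nat.cast_zero, zero_div, zero_smul, add_zero]
    refine Finset.sum_congr rfl fun l _ => ?_
    rw [map_smul, ← End.mul_apply, ← pow_succ', Nat.factorial_succ]
    congr 1
    have h2 : (l.factorial : ℂ) ≠ 0 := by exact_mod_cast l.factorial_ne_zero
    have h3 : (l : ℂ) + 1 ≠ 0 := by exact_mod_cast l.succ_ne_zero
    push_cast
    field_simp
  rw [expL_apply, X.expLOne_eq_sum hN, h1, Finset.sum_range_succ, hN N le_rfl, smul_zero, add_zero]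

theorem expL_L_one (a : V) : X.expL (X.L 1 a) = X.L 1 (X.expL a) := by
  obtain ⟨N, hN⟩ := X.exists_L_one_pow_eq_zero a
  have h1 : ∀ l, (X.L 1 ^ l) (X.L 1 a) = X.L 1 ((X.L 1 ^ l) a) := fun l => by
    rw [← End.mul_apply, ← pow_succ, pow_succ', End.mul_apply]
  rw [expL_apply, expL_apply, X.expLOne_eq_sum hN, X.expLOne_eq_sum (N := N) fun l hl => by
    rw [h1, hN l hl, map_zero], map_sum]
  refine Finset.sum_congr rfl fun l _ => ?_
  rw [h1, map_smul]

theorem L_one_pow_L_zero (l : ℕ) (a : V) :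
    (X.L 1 ^ l) (X.L 0 a) = X.L 0 ((X.L 1 ^ l) a) + (l : ℂ) • (X.L 1 ^ l) a := by
  induction l with
  | zero => simp
  | succ l ih =>
    rw [pow_succ', End.mul_apply, ih, map_add, map_smul, L_one_L_zero, End.mul_apply]
    push_cast
    module

theorem expL_L_zero (a : V) : X.expL (X.L 0 a) = X.L 0 (X.expL a) + X.L 1 (X.expL a) := by
  obtain ⟨N, hN⟩ := X.exists_L_one_pow_eq_zero a
  rw [X.L_one_expL hN, expL_apply, expL_apply, X.expLOne_eq_sum hN,
    X.expLOne_eq_sum (N := N) fun l hl => by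
      rw [L_one_pow_L_zero, hN l hl, map_zero, smul_zero, add_zero], map_sum,
    ← Finset.sum_add_distrib]
  refine Finset.sum_congr rfl fun l _ => ?_
  rw [L_one_pow_L_zero, map_smul]
  module

theorem L_one_pow_succ_T (l : ℕ) (a : V) :
    (X.L 1 ^ (l + 1)) (X.T a) = X.T ((X.L 1 ^ (l + 1)) a) +
      ((l : ℂ) + 1) • ((2 : ℂ) • X.L 0 ((X.L 1 ^ l) a) + (l : ℂ) • (X.L 1 ^ l) a) := by
  have hp : ∀ l, X.L 1 ((X.L 1 ^ l) a) = (X.L 1 ^ (l + 1)) a := fun l => by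
    rw [pow_succ', End.mul_apply]
  induction l with
  | zero => simp [L_one_T]
  | succ l ih =>
    rw [pow_succ', End.mul_apply, ih, map_add, L_one_T, map_smul, map_add, map_smul, map_smul,
      L_one_L_zero, hp, hp, ← pow_succ']
    push_cast
    module

/-- Conjugation of `T` by `e^{L_1}`: `ad L_1` sends `T` to `2 L_0`, then to `2 L_1`, then to `0`, so
three terms remain. -/
theorem expL_T (a : V) :
    X.expL (X.T a) = X.T (X.expL a) + (2 : ℂ) • X.L 0 (X.expL a) + X.L 1 (X.expL a) := by
  obtain ⟨N, hN⟩ := X.exists_L_one_pow_eq_zero a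
  have hN' : ∀ l, N + 1 ≤ l → (X.L 1 ^ l) a = 0 := fun l hl => hN l (by omega)
  have hT : ∀ l, N + 1 ≤ l → (X.L 1 ^ l) (X.T a) = 0 := by
    intro l hl
    obtain ⟨j, rfl⟩ := Nat.exists_eq_add_of_le' (le_trans (Nat.le_add_left 1 N) hl)
    rw [L_one_pow_succ_T, hN' _ hl, hN j (by omega)]
    simp
  rw [X.L_one_expL hN]
  have h1 : X.T (X.expL a) = ∑ l ∈ Finset.range (N + 1),
      (1 / (l.factorial : ℂ)) • X.T ((X.L 1 ^ l) a) := by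
    rw [expL_apply, X.expLOne_eq_sum hN', map_sum]
    simp only [map_smul]
  have h2 : (2 : ℂ) • X.L 0 (X.expL a) = ∑ l ∈ Finset.range N,
      (1 / (l.factorial : ℂ)) • (2 : ℂ) • X.L 0 ((X.L 1 ^ l) a) := by
    rw [expL_apply, X.expLOne_eq_sum hN, map_sum, Finset.smul_sum]
    refine Finset.sum_congr rfl fun l _ => ?_
    rw [map_smul, smul_comm]
  rw [h1, h2, expL_apply, X.expLOne_eq_sum hT, Finset.sum_range_succ', Finset.sum_range_succ']
  simp only [pow_zero, End.one_apply]
  rw [add_assoc, ← Finset.sum_add_distrib, add_right_comm, ← Finset.sum_add_distrib]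
  congr 1
  refine Finset.sum_congr rfl fun l _ => ?_
  rw [L_one_pow_succ_T, smul_add, smul_smul, smul_add]
  congr 1
  have h2 : (l.factorial : ℂ) ≠ 0 := by exact_mod_cast l.factorial_ne_zero
  have h3 : (l : ℂ) + 1 ≠ 0 := by exact_mod_cast l.succ_ne_zero
  have h4 : 1 / ((l + 1).factorial : ℂ) * ((l : ℂ) + 1) = 1 / (l.factorial : ℂ) := by
    rw [Nat.factorial_succ]
    push_cast
    field_simp
  rw [h4, smul_smul (1 / (l.factorial : ℂ)) (l : ℂ)]
  congr 2
  ring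

/-- Conjugation by the sign operator turns `e^{L_1}` into `e^{-L_1}`; the product of the two series
collapses by the binomial theorem for `(-1 + 1)^m`. -/
theorem expL_signOp_expL_signOp (a : V) : X.expL (X.signOp (X.expL (X.signOp a))) = a := by
  obtain ⟨N, hN⟩ := X.exists_L_one_pow_eq_zero a
  have hS : ∀ l, N ≤ l → (X.L 1 ^ l) (X.signOp a) = 0 := by
    intro l hl
    have := X.signOp_L_one_pow l a
    rw [hN l hl, map_zero] at this
    exact (smul_eq_zero.mp this.symm).resolve_left (pow_ne_zero _ (by norm_num))
  have h1 : X.signOp (X.expL (X.signOp a)) =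
      ∑ l ∈ Finset.range N, (1 / (l.factorial : ℂ) * (-1) ^ l) • (X.L 1 ^ l) a := by
    rw [expL_apply, X.expLOne_eq_sum hS, map_sum]
    refine Finset.sum_congr rfl fun l _ => ?_
    rw [map_smul, signOp_L_one_pow, signOp_signOp, smul_smul]
  have hp : ∀ k l : ℕ, (X.L 1 ^ k) ((X.L 1 ^ l) a) = (X.L 1 ^ (k + l)) a := fun k l => by
    rw [pow_add, End.mul_apply]
  have h2 : ∀ l, X.expL ((X.L 1 ^ l) a) =
      ∑ k ∈ Finset.range (N - l), (1 / (k.factorial : ℂ)) • (X.L 1 ^ (k + l)) a := by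
    intro l
    rw [expL_apply, X.expLOne_eq_sum (N := N - l) fun k hk => by rw [hp, hN _ (by omega)]]
    simp only [hp]
  rw [h1, map_sum]
  simp only [map_smul, h2, Finset.smul_sum, smul_smul]
  have h3 := Finset.sum_range_diag_flip N (fun l k : ℕ =>
    (1 / (l.factorial : ℂ) * (-1) ^ l * (1 / (k.factorial : ℂ))) • (X.L 1 ^ (k + l)) a)
  rw [← h3]
  have h4 : ∀ m ∈ Finset.range N, ∑ k ∈ Finset.range (m + 1),
      (1 / (k.factorial : ℂ) * (-1) ^ k * (1 / ((m - k).factorial : ℂ))) •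
        (X.L 1 ^ (m - k + k)) a = if m = 0 then a else 0 := by
    intro m _
    have h5 : ∀ k ∈ Finset.range (m + 1),
        (1 / (k.factorial : ℂ) * (-1) ^ k * (1 / ((m - k).factorial : ℂ))) •
        (X.L 1 ^ (m - k + k)) a =
        ((-1) ^ k * 1 ^ (m - k) * (m.choose k : ℂ)) • (1 / (m.factorial : ℂ)) • (X.L 1 ^ m) a := by
      intro k hk
      have hkm : k ≤ m := by
        rw [Finset.mem_range] at hk
        omega
      rw [Nat.sub_add_cancel hkm, smul_smul]
      congr 1
      have e1 : (k.factorial : ℂ) ≠ 0 := by exact_mod_cast k.factorial_ne_zero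
      have e2 : ((m - k).factorial : ℂ) ≠ 0 := by exact_mod_cast (m - k).factorial_ne_zero
      have e3 : (m.factorial : ℂ) ≠ 0 := by exact_mod_cast m.factorial_ne_zero
      have e4 : (m.choose k : ℂ) * k.factorial * (m - k).factorial = m.factorial := by
        exact_mod_cast Nat.choose_mul_factorial_mul_factorial hkm
      field_simp
      rw [one_pow, mul_one, ← e4]
      ring
    rw [Finset.sum_congr rfl h5, ← Finset.sum_smul, ← add_pow]
    rcases Nat.eq_zero_or_pos m with rfl | hm
    · simp
    · rw [neg_add_cancel, zero_pow hm.ne', zero_smul, if_neg hm.ne']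
  rw [Finset.sum_congr rfl h4, Finset.sum_ite_eq' (Finset.range N) 0 fun _ => a]
  split_ifs with h0
  · rfl
  · have : N = 0 := by
      rw [Finset.mem_range] at h0
      omega
    simpa using (hN 0 (by omega)).symm

/-- The involution `e^{L_1} (-1)^{2 L_0^2 + L_0}`. -/
noncomputable def flip : End ℂ V := X.expL * X.signOp

theorem flip_flip (a : V) : X.flip (X.flip a) = a := X.expL_signOp_expL_signOp a

theorem flip_L_one (a : V) : X.flip (X.L 1 a) = -X.L 1 (X.flip a) := by
  simp only [flip, End.mul_apply, signOp_L_one, map_neg, expL_L_one]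

theorem flip_L_zero (a : V) : X.flip (X.L 0 a) = X.L 0 (X.flip a) + X.L 1 (X.flip a) := by
  simp only [flip, End.mul_apply, signOp_L_zero, expL_L_zero]

theorem flip_T (a : V) :
    X.flip (X.T a) = -(X.T (X.flip a) + (2 : ℂ) • X.L 0 (X.flip a) + X.L 1 (X.flip a)) := by
  simp only [flip, End.mul_apply, signOp_T, map_neg, expL_T]

theorem flip_of_L_one_eq_zero {k : ℤ} {a : V} (ha : a ∈ X.W k) (h : X.L 1 a = 0) :
    X.flip a = weightSign k • a := by
  rw [flip, End.mul_apply, X.signOp_of_mem ha, map_smul, X.expL_eq_self h]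

theorem flip_eq_sum {k : ℤ} {a : V} (ha : a ∈ X.W k) {N : ℕ}
    (hN : ∀ l, N ≤ l → (X.L 1 ^ l) a = 0) : X.flip a =
      weightSign k • ∑ l ∈ Finset.range N, (1 / (l.factorial : ℂ)) • (X.L 1 ^ l) a := by
  rw [flip, End.mul_apply, X.signOp_of_mem ha, map_smul, expL_apply, X.expLOne_eq_sum hN]

/-- Antilinear maps that commute with `L_0` and `L_1` commute with
`e^{L_1} (-1)^{2 L_0^2 + L_0}`. -/
theorem flip_comm {θ : V →ₗ⋆[ℂ] V} (h0 : ∀ a, θ (X.L 0 a) = X.L 0 (θ a))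
    (h1 : ∀ a, θ (X.L 1 a) = X.L 1 (θ a)) (a : V) : θ (X.flip a) = X.flip (θ a) := by
  refine X.W_induction (P := fun a => θ (X.flip a) = X.flip (θ a)) (fun k a ha => ?_)
    (fun a b ha hb => by simp only [map_add, ha, hb]) a
  have hW : θ a ∈ X.W k := by
    rw [mem_W, ← h0, X.mem_W.mp ha, map_smulₛₗ]
    simp [map_ofNat]
  have hp : ∀ l, θ ((X.L 1 ^ l) a) = (X.L 1 ^ l) (θ a) := by
    intro l
    induction l with
    | zero => rfl
    | succ l ih => rw [pow_succ', End.mul_apply, h1, ih, End.mul_apply]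
  obtain ⟨N, hN⟩ := X.exists_L_one_pow_eq_zero a
  rw [X.flip_eq_sum ha hN, X.flip_eq_sum (N := N) hW fun l hl => by
    rw [← hp, hN l hl, map_zero], map_smulₛₗ, star_weightSign, map_sum]
  congr 1
  refine Finset.sum_congr rfl fun l _ => ?_
  rw [map_smulₛₗ, hp]
  simp

end ExpLOne

end VOSA

end VertexSuper

/-! ### Adjoints and their existence -/

namespace VertexSuper

open Module

namespace VOSA

variable {V : Type*} [AddCommGroup V] [Module ℂ V]

section Adjoint

variable (s : InnerProductSpace.Core ℂ V)

theorem inner_conj (a b : V) : starRingEnd ℂ (s.inner a b) = s.inner b a := s.conj_inner_symm b a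

theorem inner_add_left (a b c : V) : s.inner (a + b) c = s.inner a c + s.inner b c :=
  s.add_left a b c

theorem inner_add_right (a b c : V) : s.inner a (b + c) = s.inner a b + s.inner a c :=
  @InnerProductSpace.Core.inner_add_right ℂ V _ _ _ s.toCore a b c

theorem inner_smul_left (r : ℂ) (a b : V) :
    s.inner (r • a) b = starRingEnd ℂ r * s.inner a b := s.smul_left a b r

theorem inner_smul_right (r : ℂ) (a b : V) : s.inner a (r • b) = r * s.inner a b :=
  @InnerProductSpace.Core.inner_smul_right ℂ V _ _ _ s.toCore a b r

theorem inner_zero_left (a : V) : s.inner 0 a = 0 := by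
  simpa using inner_smul_left s 0 0 a

theorem inner_zero_right (a : V) : s.inner a 0 = 0 := by
  simpa using inner_smul_right s 0 a 0

theorem inner_neg_right (a b : V) : s.inner a (-b) = -s.inner a b := by
  rw [← neg_one_smul ℂ b, inner_smul_right, neg_one_mul]

theorem inner_sub_right (a b c : V) : s.inner a (b - c) = s.inner a b - s.inner a c := by
  rw [sub_eq_add_neg, inner_add_right, inner_neg_right, sub_eq_add_neg]

theorem inner_sum_right {ι : Type*} (t : Finset ι) (a : V) (f : ι → V) :
    s.inner a (∑ i ∈ t, f i) = ∑ i ∈ t, s.inner a (f i) := by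
  classical
  induction t using Finset.induction_on with
  | empty => simp [inner_zero_right]
  | insert i t hi ih => rw [Finset.sum_insert hi, Finset.sum_insert hi, inner_add_right, ih]

theorem eq_zero_of_inner {a : V} (h : ∀ x, s.inner x a = 0) : a = 0 := s.definite a (h a)

theorem eq_of_inner {a b : V} (h : ∀ x, s.inner x a = s.inner x b) : a = b :=
  sub_eq_zero.mp (eq_zero_of_inner s fun x => by rw [inner_sub_right, h, sub_self])

/-- `B` is the adjoint of `A`, in the form `(A x | y) = (x | B y)`. -/
def Adj (A B : End ℂ V) : Prop := ∀ x y, s.inner (A x) y = s.inner x (B y)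

variable {s} {A B A' B' : End ℂ V}

theorem Adj.symm (h : Adj s A B) : Adj s B A := fun x y => by
  rw [← inner_conj, ← h, inner_conj]

theorem Adj.isAdjoint (h : Adj s A B) : IsAdjoint s A B := fun x y => (h.symm x y).symm

theorem IsAdjoint.adj (h : IsAdjoint s A B) : Adj s A B := Adj.symm fun x y => (h x y).symm

theorem Adj.add (h : Adj s A B) (h' : Adj s A' B') : Adj s (A + A') (B + B') := fun x y => by
  rw [LinearMap.add_apply, LinearMap.add_apply, inner_add_left, inner_add_right, h, h']

theorem Adj.smul (h : Adj s A B) (r : ℂ) : Adj s (r • A) (starRingEnd ℂ r • B) := fun x y => by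
  rw [LinearMap.smul_apply, LinearMap.smul_apply, inner_smul_left, inner_smul_right, h]

theorem Adj.sub (h : Adj s A B) (h' : Adj s A' B') : Adj s (A - A') (B - B') := by
  have := h.add (h'.smul (-1))
  simpa [sub_eq_add_neg] using this

theorem Adj.mul (h : Adj s A B) (h' : Adj s A' B') : Adj s (A * A') (B' * B) := fun x y => by
  rw [End.mul_apply, End.mul_apply, h, h']

theorem adj_zero : Adj s (0 : End ℂ V) 0 := fun x y => by
  rw [LinearMap.zero_apply, LinearMap.zero_apply, inner_zero_left, inner_zero_right]

theorem Adj.unique (h : Adj s A B) (h' : Adj s A B') : B = B' :=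
  LinearMap.ext fun y => eq_of_inner s fun x => by rw [← h, h']

variable (s)

/-- The Riesz representation theorem on a finite-dimensional subspace. -/
theorem exists_mem_inner_eq (U : Submodule ℂ V) [FiniteDimensional ℂ U] (f : V →ₗ[ℂ] ℂ) :
    ∃ u ∈ U, ∀ x ∈ U, s.inner u x = f x := by
  let := s.toNormedAddCommGroup
  let _ : InnerProductSpace ℂ V := InnerProductSpace.ofCore s.toCore
  have : CompleteSpace U := FiniteDimensional.complete ℂ U
  let g : StrongDual ℂ U := LinearMap.toContinuousLinearMap (f ∘ₗ U.subtype)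
  refine ⟨((InnerProductSpace.toDual ℂ U).symm g : U), Subtype.property _, fun x hx => ?_⟩
  exact InnerProductSpace.toDual_symm_apply (x := (⟨x, hx⟩ : U)) (y := g)

variable {s}

theorem exists_adj (h : ∀ y, ∃ z, ∀ x, s.inner (A x) y = s.inner x z) : ∃ B, Adj s A B := by
  choose f hf using h
  refine ⟨{ toFun := f, map_add' := fun y y' => ?_, map_smul' := fun r y => ?_ },
    fun x y => hf y x⟩
  · refine eq_of_inner s fun x => ?_
    rw [inner_add_right, ← hf, ← hf, ← hf, inner_add_right]
  · refine eq_of_inner s fun x => ?_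
    rw [RingHom.id_apply, inner_smul_right, ← hf, ← hf, inner_smul_right]

end Adjoint

variable (X : VOSA V) {s : InnerProductSpace.Core ℂ V}

instance finiteDimensional_W (k : ℤ) : FiniteDimensional ℂ (X.W k) := by
  unfold W
  rw [L_zero_eq]
  exact X.finite_dim k

theorem exists_W_eq_bot : ∃ M : ℤ, ∀ k < M, X.W k = ⊥ := by
  obtain ⟨M, -, hM⟩ := X.bounded_below
  refine ⟨2 * M, fun k hk => ?_⟩
  unfold W
  rw [L_zero_eq]
  refine hM k ?_
  have : (k : ℝ) < 2 * M := by exact_mod_cast hk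
  linarith

theorem inner_eq_zero_of_ne (h0 : Adj s (X.L 0) (X.L 0)) {k l : ℤ} (hkl : k ≠ l) {a b : V}
    (ha : a ∈ X.W k) (hb : b ∈ X.W l) : s.inner a b = 0 := by
  have h := h0 a b
  rw [X.mem_W.mp ha, X.mem_W.mp hb, inner_smul_left, inner_smul_right] at h
  have h1 : starRingEnd ℂ ((k : ℂ) / 2) = (k : ℂ) / 2 := by simp [map_ofNat]
  rw [h1] at h
  have h2 : ((k : ℂ) - l) * s.inner a b = 0 := by linear_combination 2 * h
  refine (mul_eq_zero.mp h2).resolve_left ?_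
  exact sub_ne_zero.mpr (by exact_mod_cast hkl)

/-- Operators that shift the grading have adjoints, which shift the grading backwards. -/
theorem exists_adj_of_shift (h0 : Adj s (X.L 0) (X.L 0)) {A : End ℂ V} {r : ℤ}
    (hA : ∀ j, ∀ x ∈ X.W j, A x ∈ X.W (j + r)) : ∃ B, Adj s A B := by
  refine exists_adj fun y => ?_
  refine X.W_induction (P := fun y => ∃ z, ∀ x, s.inner (A x) y = s.inner x z)
    (fun i y hy => ?_) (fun y y' ⟨z, hz⟩ ⟨z', hz'⟩ => ⟨z + z', fun x => by
      rw [inner_add_right, inner_add_right, hz, hz']⟩) y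
  let f : V →ₗ[ℂ] ℂ :=
    { toFun := fun x => s.inner y (A x)
      map_add' := fun x x' => by rw [map_add, inner_add_right]
      map_smul' := fun c x => by
        rw [map_smul, inner_smul_right]
        rfl }
  -- Only `x` of weight `(i - r) / 2` can have `(A x | y) ≠ 0`, so a vector representing the
  -- functional on that weight space represents it everywhere.
  obtain ⟨z, hz, hzf⟩ := exists_mem_inner_eq s (X.W (i - r)) f
  refine ⟨z, fun x => ?_⟩
  refine X.W_induction (P := fun x => s.inner (A x) y = s.inner x z)
    (fun j x hx => ?_) (fun x x' hx hx' => by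
      rw [map_add, inner_add_left, inner_add_left, hx, hx']) x
  by_cases hj : j = i - r
  · subst hj
    rw [← inner_conj s z, hzf x hx, ← inner_conj]
    rfl
  · rw [X.inner_eq_zero_of_ne h0 (by omega) (hA j x hx) hy,
      X.inner_eq_zero_of_ne h0 hj hx hz]

theorem adj_shift (h0 : Adj s (X.L 0) (X.L 0)) {A B : End ℂ V} {r : ℤ}
    (hA : ∀ j, ∀ x ∈ X.W j, A x ∈ X.W (j + r)) (hB : Adj s A B) (i : ℤ) {y : V}
    (hy : y ∈ X.W i) : B y ∈ X.W (i - r) := by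
  rw [mem_W, ← sub_eq_zero]
  refine eq_zero_of_inner s fun x => ?_
  refine X.W_induction (P := fun x => s.inner x (X.L 0 (B y) - (((i - r : ℤ) : ℂ) / 2) • B y) = 0)
    (fun j x hx => ?_) (fun x x' hx hx' => by rw [inner_add_left, hx, hx', add_zero]) x
  rw [inner_sub_right, inner_smul_right, ← h0, X.mem_W.mp hx, inner_smul_left, ← hB]
  have h1 : starRingEnd ℂ ((j : ℂ) / 2) = (j : ℂ) / 2 := by simp [map_ofNat]
  rw [h1]
  by_cases hj : j = i - r
  · rw [hj, sub_self]
  · rw [X.inner_eq_zero_of_ne h0 (by omega) (hA j x hx) hy, mul_zero, mul_zero, sub_zero]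

/-- The coefficients of vertex operators have adjoints. -/
theorem exists_adj_Y (h0 : Adj s (X.L 0) (X.L 0)) (a : V) (n : ℤ) :
    ∃ B : End ℂ V, Adj s (X.Y a n) B := by
  refine X.W_induction (P := fun a => ∃ B : End ℂ V, Adj s (X.Y a n) B) (fun k a ha => ?_)
    (fun a a' ⟨B, hB⟩ ⟨B', hB'⟩ => ⟨B + B', by
      rw [map_add, Pi.add_apply]
      exact hB.add hB'⟩) a
  refine X.exists_adj_of_shift h0 (r := k - 2 * n - 2) fun j x hx => ?_
  convert X.Y_mem_W ha hx n using 2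
  ring

/-! ### Consequences of positivity under Möbius symmetry -/

section Mobius

theorem HasUnitaryMobiusSymmetry.L_zero {X : VOSA V} (hM : X.HasUnitaryMobiusSymmetry s) :
    Adj s (X.L 0) (X.L 0) := hM 0 (by simp)

theorem HasUnitaryMobiusSymmetry.L_one {X : VOSA V} (hM : X.HasUnitaryMobiusSymmetry s) :
    Adj s (X.L 1) X.T := by
  rw [← L_neg_one_eq]
  exact hM 1 (by simp)

/-- As `T` is the adjoint of `L_1`, the norm is `(a | [L_1, L_{-1}] a) = 2 (a | L_0 a)`. -/
theorem inner_T_T (hM : X.HasUnitaryMobiusSymmetry s) {k : ℤ} {a : V} (ha : a ∈ X.W k)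
    (h1 : X.L 1 a = 0) : s.inner (X.T a) (X.T a) = k * s.inner a a := by
  rw [hM.L_one.symm, L_one_T, h1, map_zero, zero_add, X.mem_W.mp ha, inner_smul_right,
    inner_smul_right]
  ring

/-- Induction upwards from the lower bound of the weights: `L_1` maps into a space already known to
vanish, so `inner_T_T` applies with a negative factor. -/
theorem W_eq_bot_of_neg (hM : X.HasUnitaryMobiusSymmetry s) {k : ℤ} (hk : k < 0) :
    X.W k = ⊥ := by
  obtain ⟨M, h⟩ := X.exists_W_eq_bot
  have key : ∀ n : ℕ, ∀ k < M + n, k < 0 → X.W k = ⊥ := by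
    intro n
    induction n with
    | zero => exact fun k hk _ => h k (by simpa using hk)
    | succ n ih =>
      intro k hk hk0
      rw [eq_bot_iff]
      intro a ha
      have h1 : X.L 1 a = 0 := by
        have := X.L_one_mem_W ha
        rw [ih (k - 2) (by push_cast at hk; omega) (by omega)] at this
        simpa using this
      have h2 := X.inner_T_T hM ha h1
      have h3 : 0 ≤ (s.inner (X.T a) (X.T a)).re := s.re_inner_nonneg _
      have h4 : 0 ≤ (s.inner a a).re := s.re_inner_nonneg _
      have h5 : (s.inner a a).im = 0 := Complex.conj_eq_iff_im.mp (inner_conj s a a)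
      rw [h2, ← Complex.ofReal_intCast, Complex.re_ofReal_mul] at h3
      have hk' : (k : ℝ) < 0 := by exact_mod_cast hk0
      have h6 : (s.inner a a).re = 0 := le_antisymm (by nlinarith) h4
      exact s.definite a (Complex.ext h6 h5)
  exact key (k - M + 1).toNat k (by omega) hk

theorem L_one_eq_zero (hM : X.HasUnitaryMobiusSymmetry s) {k : ℤ} (hk : k < 2) {a : V}
    (ha : a ∈ X.W k) : X.L 1 a = 0 := by
  have := X.L_one_mem_W ha
  rw [X.W_eq_bot_of_neg hM (by omega)] at this
  simpa using this

theorem T_eq_zero (hM : X.HasUnitaryMobiusSymmetry s) {a : V} (ha : a ∈ X.W 0) : X.T a = 0 := by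
  refine s.definite _ ?_
  rw [X.inner_T_T hM ha (X.L_one_eq_zero hM (by norm_num) ha)]
  simp

/-- The space `V` is spanned by the vectors `T^j a` with `a` quasi-primary. -/
theorem quasiPrimary_induction (hM : X.HasUnitaryMobiusSymmetry s) {P : V → Prop}
    (hqp : ∀ (k : ℤ) (a : V), a ∈ X.W k → X.L 1 a = 0 → P a)
    (hT : ∀ (k : ℤ) (a : V), a ∈ X.W k → P a → P (X.T a))
    (hadd : ∀ a b, P a → P b → P (a + b)) (a : V) : P a := by
  refine X.W_induction (fun k a ha => ?_) hadd a
  have key : ∀ n : ℕ, ∀ k < (n : ℤ), ∀ a ∈ X.W k, P a := by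
    intro n
    induction n with
    | zero =>
      intro k hk a ha
      rw [X.W_eq_bot_of_neg hM (by simpa using hk), Submodule.mem_bot] at ha
      subst ha
      exact hqp 0 0 (zero_mem _) (map_zero _)
    | succ n ih =>
      intro k hk a ha
      let f : V →ₗ[ℂ] ℂ :=
        { toFun := fun x => s.inner a x
          map_add' := fun x x' => inner_add_right s _ _ _
          map_smul' := fun c x => inner_smul_right s _ _ _ }
      -- `u = T w` is the orthogonal projection of `a` to the image of `T`; the remainder is
      -- quasi-primary because `L_1` is the adjoint of `T`.
      obtain ⟨u, hu, huf⟩ := exists_mem_inner_eq s ((X.W (k - 2)).map X.T) f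
      obtain ⟨w, hw, rfl⟩ := hu
      have hTw : X.T w ∈ X.W k := by
        have := X.T_mem_W hw
        rwa [sub_add_cancel] at this
      have hd : a - X.T w ∈ X.W k := sub_mem ha hTw
      rw [show a = (a - X.T w) + X.T w by abel]
      refine hadd _ _ (hqp k _ hd ?_) (hT _ w hw (ih (k - 2) (by push_cast at hk; omega) w hw))
      refine s.definite _ ?_
      have hy := X.L_one_mem_W hd
      have h1 := huf (X.T (X.L 1 (a - X.T w))) (Submodule.mem_map_of_mem hy)
      have h2 : s.inner (X.T (X.L 1 (a - X.T w))) (X.T w) =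
          s.inner (X.T (X.L 1 (a - X.T w))) a := by
        rw [← inner_conj, h1]
        exact inner_conj s a _
      rw [hM.L_one, ← inner_conj, inner_sub_right, h2, sub_self, map_zero]
  exact key (k + 1).toNat k (by omega) a ha

end Mobius

end VOSA

end VertexSuper

/-! ### Stability of locality, and invariance as an adjoint formula -/

namespace VertexSuper

open Module

section

variable {V : Type*} [AddCommGroup V] [Module ℂ V] {Γ : End ℂ V} {F F' G : ℤ → End ℂ V}

theorem MutuallyLocal.add (h : MutuallyLocal Γ F G) (h' : MutuallyLocal Γ F' G) :
    MutuallyLocal Γ (F + F') G := by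
  rw [mutuallyLocal_iff] at *
  convert add_mem h h' using 1
  funext m k
  simp only [gradedCommutator, evenPart, oddPart, Pi.add_apply, mul_add, add_mul, mul_smul_comm,
    mul_sub]
  module

theorem MutuallyLocal.smul (h : MutuallyLocal Γ F G) (r : ℂ) : MutuallyLocal Γ (r • F) G := by
  rw [mutuallyLocal_iff] at *
  convert Submodule.smul_mem _ r h using 1
  funext m k
  simp only [gradedCommutator, evenPart, oddPart, Pi.smul_apply, mul_smul_comm, smul_mul_assoc,
    smul_sub, smul_add, mul_add, mul_sub]
  module

theorem mutuallyLocal_zero : MutuallyLocal Γ 0 G := by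
  rw [mutuallyLocal_iff]
  convert Submodule.zero_mem (nil (zSubW (End ℂ V))) using 1
  funext m k
  simp [gradedCommutator, evenPart, oddPart]

theorem MutuallyLocal.sum {ι : Type*} (t : Finset ι) {f : ι → ℤ → End ℂ V}
    (h : ∀ i ∈ t, MutuallyLocal Γ (f i) G) : MutuallyLocal Γ (∑ i ∈ t, f i) G :=
  Finset.sum_induction f (fun F => MutuallyLocal Γ F G) (fun _ _ => MutuallyLocal.add)
    mutuallyLocal_zero h

/-- A shift of the index is multiplication by a power of `z`, which commutes with `z - w`. -/
theorem MutuallyLocal.shift (h : MutuallyLocal Γ F G) (c : ℤ) :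
    MutuallyLocal Γ (fun n => F (n + c)) G := by
  rw [mutuallyLocal_iff] at *
  let φ : (ℤ → ℤ → End ℂ V) →ₗ[ℂ] (ℤ → ℤ → End ℂ V) :=
    { toFun := fun D m k => D (m + c) k
      map_add' := fun _ _ => rfl
      map_smul' := fun _ _ => rfl }
  exact map_mem_nil (T' := zSubW (End ℂ V)) φ (fun D => by
    funext m k
    simp [φ, zSubW_apply, add_right_comm]) h

end

namespace VOSA

variable {V : Type*} [AddCommGroup V] [Module ℂ V] {X : VOSA V} {s : InnerProductSpace.Core ℂ V}

section Invariance

/-- The powers of `z` in the invariance formula only shift indices; all terms are modes of one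
degree, and they add up to a mode of `flip a`. -/
theorem mode_flip (X : VOSA V) {k : ℤ} {a : V} (ha : a ∈ X.W k) (m : ℤ) {N : ℕ}
    (hN : ∀ l, N ≤ l → (X.L 1 ^ l) a = 0) :
    X.mode (k - 2 * (m + 1)) (X.flip a) = weightSign k • ∑ l ∈ Finset.range N,
      (1 / (l.factorial : ℂ)) • X.Y ((X.L 1 ^ l) a) (k - m - 2 - l) := by
  rw [X.flip_eq_sum ha hN, map_smul, map_sum]
  congr 1
  refine Finset.sum_congr rfl fun l _ => ?_
  rw [map_smul, X.mode_eq (X.L_one_pow_mem_W ha l)]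
  ring

theorem mode_flip_of_not_even (X : VOSA V) {h k : ℤ} {a : V} (ha : a ∈ X.W k)
    (hk : ¬Even (h + k)) : X.mode h (X.flip a) = 0 := by
  obtain ⟨N, hN⟩ := X.exists_L_one_pow_eq_zero a
  rw [X.flip_eq_sum ha hN, map_smul, map_sum, Finset.sum_eq_zero, smul_zero]
  intro l _
  rw [map_smul, X.mode_of_not_even (X.L_one_pow_mem_W ha l), smul_zero]
  rwa [show h + (k - 2 * (l : ℤ)) = h + k - 2 * l by ring, Int.even_sub,
    iff_true_right (even_two_mul _)]

theorem isInvariant_iff {θ : V →ₗ⋆[ℂ] V} (hθ : ∀ k, ∀ a ∈ X.W k, θ a ∈ X.W k) :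
    X.IsInvariant s θ ↔ ∀ h a, Adj s (X.mode h (θ a)) (X.mode (-h) (X.flip a)) := by
  have key : ∀ (k : ℤ) (a : V), a ∈ X.W k → ∀ (b c : V) (m : ℤ),
      weightSign k * ∑ᶠ l : ℕ, (1 / (l.factorial : ℂ)) *
        s.inner b (X.Y ((X.L 1 ^ l) a) (k - m - 2 - l) c) =
      s.inner b (X.mode (k - 2 * (m + 1)) (X.flip a) c) := by
    intro k a ha b c m
    obtain ⟨N, hN⟩ := X.exists_L_one_pow_eq_zero a
    rw [X.mode_flip ha m hN, LinearMap.smul_apply, inner_smul_right, LinearMap.sum_apply,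
      inner_sum_right]
    congr 1
    rw [finsum_eq_sum_of_support_subset (s := Finset.range N)]
    · refine Finset.sum_congr rfl fun l _ => ?_
      rw [LinearMap.smul_apply, inner_smul_right]
    · intro l hl
      by_contra h
      simp only [Finset.coe_range, Set.mem_Iio, not_lt] at h
      exact hl (by simp [hN l h, inner_zero_right])
  constructor
  · intro hinv h a
    refine X.W_induction (P := fun a => Adj s (X.mode h (θ a)) (X.mode (-h) (X.flip a)))
      (fun k a ha => ?_) (fun a b ha hb => by simpa only [map_add] using ha.add hb) a
    by_cases hk : Even (h + k)
    · obtain ⟨n, hn⟩ := hk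
      intro b c
      rw [X.mode_eq (n := n - 1) (hθ k a ha) (by omega), hinv k a ha, key k a ha,
        show k - 2 * (n - 1 + 1) = -h by omega]
    · rw [X.mode_of_not_even (hθ k a ha) hk, X.mode_flip_of_not_even ha]
      · exact adj_zero
      · rwa [Int.even_add, even_neg, ← Int.even_add]
  · intro h k a ha b c m
    rw [key k a ha, X.Y_eq_mode (hθ k a ha), h, neg_sub]

end Invariance

/-! ### From a PCT operator to the involution and to local adjoints -/

section PCT

variable {θ : V →ₗ⋆[ℂ] V}

theorem IsPCT.map_L (hθ : X.IsPCT s θ) (n : ℤ) (a : V) : θ (X.L n a) = X.L n (θ a) := by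
  rw [L, hθ.map_product, hθ.map_conformal]

theorem mem_W_of_comm (h0 : ∀ a, θ (X.L 0 a) = X.L 0 (θ a)) {k : ℤ} {a : V} (ha : a ∈ X.W k) :
    θ a ∈ X.W k := by
  rw [mem_W, ← h0, X.mem_W.mp ha, map_smulₛₗ]
  simp [map_ofNat]

theorem IsPCT.adj (hθ : X.IsPCT s θ) (h : ℤ) (a : V) :
    Adj s (X.mode h a) (X.mode (-h) (X.flip (θ a))) := by
  have := (isInvariant_iff fun k a => mem_W_of_comm (hθ.map_L 0)).mp hθ.invariant h (θ a)
  rwa [hθ.involutive] at this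

/-- Fixing `ν`, `θ` commutes with all `L_n`, hence with `flip`, and two commuting involutions
compose to one. For `ν`, `k = 4` and the sign is `(-1)^10 = 1`. -/
theorem IsPCT.isAdjointInvolution (hθ : X.IsPCT s θ) :
    X.IsAdjointInvolution s (X.flip.comp θ) where
  involutive a := by
    simp only [LinearMap.comp_apply]
    rw [X.flip_comm (hθ.map_L 0) (hθ.map_L 1), X.flip_flip, hθ.involutive]
  map_conformal := by
    rw [LinearMap.comp_apply, hθ.map_conformal,
      X.flip_of_L_one_eq_zero X.conformal_mem_W X.L_one_conformal]
    norm_num [weightSign]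
  adjoint a b c h := hθ.adj h a b c

/-- For homogeneous `a` the adjoint field is a finite combination of shifted fields `Y(L_1^l θ(a),
z)`, each local by the axioms. -/
theorem IsPCT.hasLocalAdjoint (hθ : X.IsPCT s θ) (a : V) : X.HasLocalAdjoint s a := by
  refine X.W_induction (P := fun a => X.HasLocalAdjoint s a) (fun k a ha => ?_)
    (fun a a' ⟨B, hB, hB'⟩ ⟨D, hD, hD'⟩ => ⟨B + D, fun n => ?_, fun b => (hB' b).add (hD' b)⟩) a
  · have hW : θ a ∈ X.W k := mem_W_of_comm (hθ.map_L 0) ha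
    obtain ⟨N, hN⟩ := X.exists_L_one_pow_eq_zero (θ a)
    refine ⟨fun n => X.mode (k - 2 * (n + 1)) (X.flip (θ a)), fun n => ?_, fun b => ?_⟩
    · rw [X.Y_eq_mode ha]
      have := hθ.adj (2 * (n + 1) - k) a
      rw [neg_sub] at this
      exact this.isAdjoint
    · have h1 : (fun n : ℤ => X.mode (k - 2 * (-n - 2 + 1)) (X.flip (θ a))) =
          weightSign k • ∑ l ∈ Finset.range N, (1 / (l.factorial : ℂ)) •
            fun n : ℤ => X.Y ((X.L 1 ^ l) (θ a)) (n + (k - l)) := by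
        funext n
        rw [X.mode_flip hW _ hN, Pi.smul_apply, Finset.sum_apply]
        congr 1
        refine Finset.sum_congr rfl fun l _ => ?_
        rw [Pi.smul_apply, show k - (-n - 2) - 2 - (l : ℤ) = n + (k - l) by ring]
      have h2 : ∀ l ∈ Finset.range N, MutuallyLocal X.Γ ((1 / (l.factorial : ℂ)) •
            fun n : ℤ => X.Y ((X.L 1 ^ l) (θ a)) (n + (k - l))) (X.Y b) :=
        fun l _ => ((X.locality _ b).shift (k - l)).smul _
      have h3 := (MutuallyLocal.sum _ h2).smul (weightSign k)
      rw [← h1] at h3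
      exact h3
  · rw [map_add, Pi.add_apply]
    exact ((hB n).adj.add (hD n).adj).isAdjoint

end PCT

/-! ### From an adjoint involution to a candidate PCT operator -/

section Involution

variable {C : V →ₗ⋆[ℂ] V}

theorem IsAdjointInvolution.adj (hC : X.IsAdjointInvolution s C) (h : ℤ) (a : V) :
    Adj s (X.mode h a) (X.mode (-h) (C a)) := fun b c => hC.adjoint a b c h

/-- Adjoints are unique and modes determine the vector; values of `C` are computed by exhibiting
adjoints. -/
theorem IsAdjointInvolution.eq_of_adj (hC : X.IsAdjointInvolution s C) {a b : V}
    (h : ∀ n, Adj s (X.mode n a) (X.mode (-n) b)) : C a = b :=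
  X.eq_of_mode_eq fun n => by
    have h1 := hC.adj (-n) a
    have h2 := h (-n)
    rw [neg_neg] at h1 h2
    exact h1.unique h2

theorem mode_vacuum (X : VOSA V) (h : ℤ) : X.mode h X.Ω = if h = 0 then 1 else 0 := by
  by_cases hh : Even h
  · obtain ⟨n, hn⟩ := hh
    rw [X.mode_eq (n := n - 1) X.vacuum_mem_W (by omega), X.vacuum_field]
    congr 1
    exact propext ⟨fun _ => by omega, fun _ => by omega⟩
  · rw [X.mode_of_not_even X.vacuum_mem_W (by simpa using hh), if_neg]
    rintro rfl
    exact hh Even.zero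

theorem IsAdjointInvolution.map_vacuum (hC : X.IsAdjointInvolution s C) : C X.Ω = X.Ω := by
  refine hC.eq_of_adj fun n => ?_
  rw [mode_vacuum, mode_vacuum]
  by_cases hn : n = 0
  · subst hn
    exact fun x y => rfl
  · rw [if_neg hn, if_neg (neg_ne_zero.mpr hn)]
    exact adj_zero

theorem IsAdjointInvolution.adj_L (hC : X.IsAdjointInvolution s C) (n : ℤ) :
    Adj s (X.L n) (X.L (-n)) := by
  have := hC.adj (2 * n) X.ν
  rwa [mode_conformal, hC.map_conformal, ← mul_neg, mode_conformal] at this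

theorem IsAdjointInvolution.mobius (hC : X.IsAdjointInvolution s C) :
    X.HasUnitaryMobiusSymmetry s := fun n _ => hC.adj_L n

/-- Adjunction replaces `h` by `-h` and so reverses the scalar by which `T + L_0` acts. -/
theorem IsAdjointInvolution.map_T_add (hC : X.IsAdjointInvolution s C) (a : V) :
    C (X.T a + X.L 0 a) = -(X.T (C a) + X.L 0 (C a)) := by
  refine hC.eq_of_adj fun h => ?_
  rw [mode_T_add, map_neg, mode_T_add]
  have := (hC.adj h a).smul (-((h : ℂ) / 2))
  convert this using 1
  rw [← neg_smul]
  congr 1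
  simp [map_ofNat, neg_div]

/-- The adjoint of `[L_1, a_n]` is `-[T, ā_{-n}]`. -/
theorem IsAdjointInvolution.map_T_add_add (hC : X.IsAdjointInvolution s C) (a : V) :
    C (X.T a + (2 : ℂ) • X.L 0 a + X.L 1 a) = -X.T (C a) := by
  refine hC.eq_of_adj fun h => ?_
  have h1 := X.L_one_comm_mode (h - 2) a
  have h2 := X.T_comm_mode (-(h - 2)) (C a)
  rw [sub_add_cancel] at h1
  rw [show -(h - 2) - 2 = -h by ring] at h2
  rw [← h1, map_neg, ← h2, neg_sub]
  have ha := hC.adj (h - 2) a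
  have hL := hC.mobius.L_one
  exact (hL.mul ha).sub (ha.mul hL)

/-- The difference of the two preceding identities is `C (L_0 + L_1) = L_0 C`, here applied to `C
a`. Together with the next two rules it gives `C` the commutation relations of `flip`. -/
theorem IsAdjointInvolution.map_L_zero (hC : X.IsAdjointInvolution s C) (a : V) :
    C (X.L 0 a) = X.L 0 (C a) + X.L 1 (C a) := by
  have h1 := hC.map_T_add (C a)
  have h2 := hC.map_T_add_add (C a)
  have h3 : C (X.L 0 (C a) + X.L 1 (C a)) = X.L 0 a := by
    simp only [map_add, map_smulₛₗ, hC.involutive] at h1 h2 ⊢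
    rw [map_ofNat, two_smul] at h2
    rw [← sub_eq_zero] at h1 h2 ⊢
    rw [show C (X.L 0 (C a)) + C (X.L 1 (C a)) - X.L 0 a =
      (C (X.T (C a)) + (C (X.L 0 (C a)) + C (X.L 0 (C a))) + C (X.L 1 (C a)) - -X.T a) -
      (C (X.T (C a)) + C (X.L 0 (C a)) - -(X.T a + X.L 0 a)) by abel, h1, h2, sub_zero]
  rw [← h3, hC.involutive]

theorem IsAdjointInvolution.map_L_one (hC : X.IsAdjointInvolution s C) (a : V) :
    C (X.L 1 a) = -X.L 1 (C a) := by
  have h1 := hC.map_T_add a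
  have h2 := hC.map_T_add_add a
  simp only [map_add, map_smulₛₗ, hC.map_L_zero] at h1 h2
  rw [map_ofNat] at h2
  rw [← sub_eq_zero] at h1 h2 ⊢
  have e : C (X.L 1 a) - -X.L 1 (C a) =
    (C (X.T a) + (2 : ℂ) • (X.L 0 (C a) + X.L 1 (C a)) + C (X.L 1 a) - -X.T (C a)) -
    (C (X.T a) + (X.L 0 (C a) + X.L 1 (C a)) - -(X.T (C a) + X.L 0 (C a))) := by module
  rw [e, h1, h2, sub_zero]

theorem IsAdjointInvolution.map_T (hC : X.IsAdjointInvolution s C) (a : V) :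
    C (X.T a) = -(X.T (C a) + (2 : ℂ) • X.L 0 (C a) + X.L 1 (C a)) := by
  have h1 := hC.map_T_add a
  rw [map_add, hC.map_L_zero] at h1
  rw [eq_sub_of_add_eq h1]
  module

variable (X C) in
/-- The PCT operator associated with an adjoint involution. -/
noncomputable def pct : V →ₗ⋆[ℂ] V := X.flip.comp C

theorem pct_apply (a : V) : X.pct C a = X.flip (C a) := rfl

theorem flip_pct (a : V) : X.flip (X.pct C a) = C a := X.flip_flip _

theorem pct_L_zero (hC : X.IsAdjointInvolution s C) (a : V) :
    X.pct C (X.L 0 a) = X.L 0 (X.pct C a) := by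
  simp only [pct_apply, hC.map_L_zero, map_add, flip_L_zero, flip_L_one]
  abel

theorem pct_L_one (hC : X.IsAdjointInvolution s C) (a : V) :
    X.pct C (X.L 1 a) = X.L 1 (X.pct C a) := by
  simp only [pct_apply, hC.map_L_one, map_neg, flip_L_one, neg_neg]

theorem pct_T (hC : X.IsAdjointInvolution s C) (a : V) :
    X.pct C (X.T a) = X.T (X.pct C a) := by
  simp only [pct_apply, hC.map_T, map_add, map_neg, map_smul, flip_L_zero, flip_L_one, flip_T]
  module

theorem pct_flip (hC : X.IsAdjointInvolution s C) (a : V) :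
    X.pct C (X.flip a) = X.flip (X.pct C a) := X.flip_comm (pct_L_zero hC) (pct_L_one hC) a

theorem pct_pct (hC : X.IsAdjointInvolution s C) (a : V) : X.pct C (X.pct C a) = a := by
  rw [X.pct_apply (C := C) (a := a), pct_flip hC, flip_pct, hC.involutive]

theorem pct_mem_W (hC : X.IsAdjointInvolution s C) {k : ℤ} {a : V} (ha : a ∈ X.W k) :
    X.pct C a ∈ X.W k := mem_W_of_comm (pct_L_zero hC) ha

theorem pct_vacuum (hC : X.IsAdjointInvolution s C) : X.pct C X.Ω = X.Ω := by
  rw [pct_apply, hC.map_vacuum, X.flip_of_L_one_eq_zero X.vacuum_mem_W X.L_one_vacuum]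
  simp [weightSign]

theorem pct_conformal (hC : X.IsAdjointInvolution s C) : X.pct C X.ν = X.ν := by
  rw [pct_apply, hC.map_conformal, X.flip_of_L_one_eq_zero X.conformal_mem_W X.L_one_conformal]
  norm_num [weightSign]

theorem pct_isInvariant (hC : X.IsAdjointInvolution s C) : X.IsInvariant s (X.pct C) := by
  rw [isInvariant_iff fun k a => pct_mem_W hC]
  intro h a
  have := hC.adj h (X.pct C a)
  rwa [← flip_pct (C := C) (X.pct C a), pct_pct hC] at this

end Involution

end VOSA

end VertexSuper

/-! ### The candidate preserves all products -/

namespace VertexSuper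

open Module

namespace VOSA

variable {V : Type*} [AddCommGroup V] [Module ℂ V] {X : VOSA V} {s : InnerProductSpace.Core ℂ V}

section QuasiPrimary

theorem L_one_comm_quasiPrimary (X : VOSA V) {k : ℤ} {a : V} (ha : a ∈ X.W k) (h1 : X.L 1 a = 0)
    (n : ℤ) :
    X.L 1 * X.Y a n - X.Y a n * X.L 1 = ((k : ℂ) - 2 - n) • X.Y a (n + 1) := by
  rw [L_one_comm_Y, Y_T, X.mem_W.mp ha, h1, map_smul, map_zero, Pi.zero_apply, add_zero,
    show n + 2 - 1 = n + 1 by ring, Pi.smul_apply]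
  push_cast
  module

theorem L_one_Y (X : VOSA V) {k : ℤ} {a b : V} (ha : a ∈ X.W k) (h1 : X.L 1 a = 0)
    (hb : X.L 1 b = 0) (n : ℤ) :
    X.L 1 (X.Y a n b) = ((k : ℂ) - 2 - n) • X.Y a (n + 1) b := by
  have := LinearMap.congr_fun (X.L_one_comm_quasiPrimary ha h1 n) b
  simpa [hb] using this

/-- Divided by `i!`, these are the binomial coefficients of Borcherds' formula at `p = k - 2 - n`;
this coincidence identifies `e^{L_1}` there. -/
theorem L_one_pow_Y (X : VOSA V) {k : ℤ} {a b : V} (ha : a ∈ X.W k) (h1 : X.L 1 a = 0)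
    (hb : X.L 1 b = 0) (n : ℤ) (i : ℕ) :
    (X.L 1 ^ i) (X.Y a n b) =
      ((i.factorial : ℂ) * Ring.choose ((k : ℂ) - 2 - n) i) • X.Y a (n + i) b := by
  induction i with
  | zero => simp
  | succ i ih =>
    have h := choose_succ_mul ((k : ℂ) - 2 - n) i
    rw [pow_succ', End.mul_apply, ih, map_smul, X.L_one_Y ha h1 hb, smul_smul, Nat.factorial_succ]
    push_cast
    rw [add_assoc]
    congr 1
    linear_combination (-(i.factorial : ℂ)) * h

end QuasiPrimary

section Automorphism

variable {C : V →ₗ⋆[ℂ] V}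

theorem map_quasiPrimary {k : ℤ} (hC : X.IsAdjointInvolution s C) {a : V} (ha : a ∈ X.W k)
    (h1 : X.L 1 a = 0) : C a = weightSign k • X.pct C a := by
  rw [← flip_pct, X.flip_of_L_one_eq_zero (pct_mem_W hC ha) (by rw [← pct_L_one hC, h1, map_zero])]

theorem adj_Y (hC : X.IsAdjointInvolution s C) {k : ℤ} {a : V} (ha : a ∈ X.W k)
    (h1 : X.L 1 a = 0) (n : ℤ) :
    Adj s (X.Y a n) (weightSign k • X.Y (X.pct C a) (k - 2 - n)) := by
  have := hC.adj (2 * (n + 1) - k) a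
  rwa [map_quasiPrimary hC ha h1, map_smul, X.mode_eq (n := n) ha (by ring),
    X.mode_eq (n := k - 2 - n) (pct_mem_W hC ha) (by ring)] at this

/-- Adjunction reverses products, which gives the factor `-(-1)^{k l}`; every factor `z - w`
contributes a further `-1` and lowers both indices by one. -/
theorem comm_adj (hC : X.IsAdjointInvolution s C) {k l : ℤ} {a b : V} (ha : a ∈ X.W k)
    (hb : b ∈ X.W l) (ha1 : X.L 1 a = 0) (hb1 : X.L 1 b = 0) (n : ℕ) (p q : ℤ) :
    Adj s (X.comm ((-1) ^ (k * l)) a b n p q)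
      (((-1) ^ (n + 1) * (-1) ^ (k * l) * weightSign k * weightSign l) •
        X.comm ((-1) ^ (k * l)) (X.pct C a) (X.pct C b) n (k - 2 - n - p) (l - 2 - n - q)) := by
  induction n generalizing p q with
  | zero =>
    have hA := adj_Y hC ha ha1 p
    have hB := adj_Y hC hb hb1 q
    have h := (hA.mul hB).sub ((hB.mul hA).smul ((-1) ^ (k * l)))
    rw [X.comm_zero, X.comm_zero]
    convert h using 1
    have e : starRingEnd ℂ ((-1 : ℂ) ^ (k * l)) = (-1) ^ (k * l) := by simp
    have e2 := neg_one_zpow_mul_self (k * l)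
    rw [e]
    simp only [smul_mul_assoc, mul_smul_comm, smul_sub, smul_smul, Nat.cast_zero, sub_zero]
    rw [show (-1 : ℂ) ^ (0 + 1) * (-1) ^ (k * l) * weightSign k * weightSign l * (-1) ^ (k * l) =
      -(weightSign k * weightSign l) by linear_combination -(weightSign k * weightSign l) * e2]
    module
  | succ n ih =>
    have h1 := ih (p + 1) q
    have h2 := ih p (q + 1)
    rw [X.comm_succ, X.comm_succ]
    convert h1.sub h2 using 1
    push_cast
    rw [show k - 2 - ((n : ℤ) + 1) - p + 1 = k - 2 - n - p by ring,
      show l - 2 - ((n : ℤ) + 1) - q + 1 = l - 2 - n - q by ring,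
      show k - 2 - (n : ℤ) - (p + 1) = k - 2 - (n + 1) - p by ring,
      show l - 2 - (n : ℤ) - (q + 1) = l - 2 - (n + 1) - q by ring,
      pow_succ (-1 : ℂ) (n + 1)]
    module

theorem comm_eq_Y (X : VOSA V) {k l : ℤ} {a b : V} (ha : a ∈ X.W k) (hb : b ∈ X.W l) (n : ℕ)
    (q : ℤ) : X.comm ((-1) ^ (k * l)) a b n 0 q = X.Y (X.Y a n b) q := by
  obtain ⟨N, hN⟩ := X.field a b
  rw [← parity_mul, X.comm_eq_productSum (X.parity_of_mem_W ha) (X.parity_of_mem_W hb) hN,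
    X.productSum_zero]

/-- The modes of `a_(n) b` are the coefficients `p = 0` of `(z - w)^n [Y(a, z), Y(b, w)]`. Their
adjoints are coefficients `p = k - 2 - n` for `θ a`, `θ b`, which the commutator formula and
`L_one_pow_Y` recognise as modes of `flip` of the product. -/
theorem pct_Y_natCast_quasiPrimary (hC : X.IsAdjointInvolution s C) {k l : ℤ} {a b : V}
    (ha : a ∈ X.W k) (hb : b ∈ X.W l) (ha1 : X.L 1 a = 0) (hb1 : X.L 1 b = 0) (n : ℕ) :
    X.pct C (X.Y a n b) = X.Y (X.pct C a) n (X.pct C b) := by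
  have ha' := pct_mem_W hC ha
  have hb' := pct_mem_W hC hb
  have ha1' : X.L 1 (X.pct C a) = 0 := by rw [← pct_L_one hC, ha1, map_zero]
  have hb1' : X.L 1 (X.pct C b) = 0 := by rw [← pct_L_one hC, hb1, map_zero]
  suffices h : C (X.Y a n b) = X.flip (X.Y (X.pct C a) n (X.pct C b)) by
    rw [X.pct_apply (C := C) (a := X.Y a n b), h, X.flip_flip]
  refine hC.eq_of_adj fun h => ?_
  have hW := X.Y_mem_W ha hb n
  have hW' := X.Y_mem_W ha' hb' n
  by_cases he : Even (h + (k + l - 2 * n - 2))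
  · obtain ⟨m, hm⟩ := he
    obtain ⟨N, hN⟩ := X.field (X.pct C a) (X.pct C b)
    have hpow : ∀ i, N + 1 ≤ i → (X.L 1 ^ i) (X.Y (X.pct C a) n (X.pct C b)) = 0 := by
      intro i hi
      rw [X.L_one_pow_Y ha' ha1' hb1', hN _ (by omega), smul_zero]
    rw [X.mode_eq (n := m - 1) hW (by omega),
      show -h = k + l - 2 * n - 2 - 2 * (m - 1 + 1) by omega, X.mode_flip hW' _ hpow,
      ← X.comm_eq_Y ha hb]
    have h1 := comm_adj hC ha hb ha1 hb1 n 0 (m - 1)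
    rw [← parity_mul, X.comm_eq_productSum (X.parity_of_mem_W ha') (X.parity_of_mem_W hb') hN,
      parity_mul] at h1
    convert h1 using 1
    rw [VertexSuperalgebra.productSum]
    congr 1
    -- The sign from `comm_adj` is the weight sign of `a_(n) b`, whose doubled weight is `k + l - 2
    -- (n + 1)`.
    · rw [show k + l - 2 * (n : ℤ) - 2 = k + l - 2 * ((n + 1 : ℕ) : ℤ) by push_cast; ring,
        weightSign_sub_two_mul, weightSign_add]
      ring
    · refine Finset.sum_congr rfl fun i _ => ?_
      have h2 : (i.factorial : ℂ) ≠ 0 := by exact_mod_cast i.factorial_ne_zero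
      rw [X.L_one_pow_Y ha' ha1' hb1', map_smul, Pi.smul_apply, smul_smul]
      congr 1
      · push_cast
        rw [sub_zero, ← mul_assoc, one_div, inv_mul_cancel₀ h2, one_mul]
      · rw [show k + l - 2 * (n : ℤ) - 2 - (m - 1) - 2 - i =
          k - 2 - n - 0 + (l - 2 - n - (m - 1)) - i by ring]
  · rw [X.mode_of_not_even hW he, X.mode_flip_of_not_even hW']
    · exact adj_zero
    · rwa [Int.even_add, even_neg, ← Int.even_add]

theorem Y_apply_T (X : VOSA V) (a b : V) (n : ℤ) :
    X.Y a n (X.T b) = X.T (X.Y a n b) + (n : ℂ) • X.Y a (n - 1) b := by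
  have := LinearMap.congr_fun (X.translation a n) b
  simp only [LinearMap.sub_apply, End.mul_apply, LinearMap.smul_apply] at this
  rw [sub_eq_iff_eq_add.mp this]
  module

theorem pct_Y_natCast (hC : X.IsAdjointInvolution s C) {k : ℤ} {a : V} (ha : a ∈ X.W k)
    (ha1 : X.L 1 a = 0) (n : ℕ) (b : V) :
    X.pct C (X.Y a n b) = X.Y (X.pct C a) n (X.pct C b) := by
  refine X.quasiPrimary_induction hC.mobius
    (P := fun b => ∀ n : ℕ, X.pct C (X.Y a n b) = X.Y (X.pct C a) n (X.pct C b))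
    (fun l b hb hb1 n => pct_Y_natCast_quasiPrimary hC ha hb ha1 hb1 n) (fun l b _ hb n => ?_)
    (fun b b' hb hb' n => by simp only [map_add, hb, hb']) b n
  rw [Y_apply_T, map_add, pct_T hC, hb, pct_T hC, Y_apply_T, map_smulₛₗ]
  congr 1
  -- For `n = 0` the negative index `n - 1` comes with the factor `0`, so only natural indices are
  -- needed.
  cases n with
  | zero => simp
  | succ n =>
    have h1 : ((n + 1 : ℕ) : ℤ) - 1 = n := by push_cast; ring
    rw [h1, hb]
    simp

/-! ### Vectors of weight zero -/

section Central

variable {a : V}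

/-- Here `T a = 0`, so the field `Y(a, z)` is constant. -/
theorem Y_of_mem_W_zero (hM : X.HasUnitaryMobiusSymmetry s) (ha : a ∈ X.W 0) {n : ℤ}
    (hn : n ≠ -1) : X.Y a n = 0 := by
  have h := X.Y_T a (n + 1)
  rw [X.T_eq_zero hM ha, map_zero, Pi.zero_apply, add_sub_cancel_right] at h
  refine (smul_eq_zero.mp h.symm).resolve_left ?_
  exact neg_ne_zero.mpr (by exact_mod_cast (by omega : n + 1 ≠ 0))

theorem commute_of_mem_W_zero (hM : X.HasUnitaryMobiusSymmetry s) (ha : a ∈ X.W 0) (b : V)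
    (q : ℤ) : X.Y a (-1) * X.Y b q = X.Y b q * X.Y a (-1) := by
  refine X.parity_induction
    (P := fun b => X.Y a (-1) * X.Y b q = X.Y b q * X.Y a (-1)) (fun t b hb => ?_)
    (fun b b' hb hb' => by rw [map_add, Pi.add_apply, mul_add, add_mul, hb, hb']) b
  have h := X.comm_eq_productSum (X.parity_of_mem_W ha) hb (N := 0) (fun j hj => by
    rw [Y_of_mem_W_zero hM ha (by omega), LinearMap.zero_apply]) 0 (-1) q
  rw [X.comm_zero] at h
  have h0 : X.Y a 0 = 0 := Y_of_mem_W_zero hM ha (by norm_num)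
  simpa [VertexSuperalgebra.productSum, paritySign, h0, sub_eq_zero] using h

/-- As `a_(-1)` is central, the right side is a covariant local field creating `a_(-1) b` from `Ω`;
Goddard's theorem applies. -/
theorem Y_Y_of_mem_W_zero (hM : X.HasUnitaryMobiusSymmetry s) (ha : a ∈ X.W 0) {l : ℤ} {b : V}
    (hb : b ∈ X.W l) (q : ℤ) : X.Y (X.Y a (-1) b) q = X.Y a (-1) * X.Y b q := by
  have hT : X.T * X.Y a (-1) = X.Y a (-1) * X.T := by
    rw [← sub_eq_zero, T_comm_Y, X.T_eq_zero hM ha, map_zero, Pi.zero_apply]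
  have hcov : X.Covariant (fun n => X.Y a (-1) * X.Y b n) := by
    refine ⟨fun n => ?_, 0, fun n hn => ?_⟩
    · rw [← mul_assoc, hT, mul_assoc, mul_assoc, ← mul_sub, X.translation, mul_smul_comm]
    · rw [End.mul_apply, X.vacuum_apply _ (by simpa using hn), map_zero]
  have hW : X.Y a (-1) b ∈ X.W l := by
    have := X.Y_mem_W ha hb (-1)
    rwa [show 0 + l - 2 * -1 - 2 = l by ring] at this
  have h := hcov.eq_Y (X.parity_of_mem_W hW) (by rw [End.mul_apply, X.creation])
    fun t c hc => (X.signLocal_Y (X.parity_of_mem_W hb) hc).mul_left _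
      (commute_of_mem_W_zero hM ha c)
  exact (congr_fun h q).symm

/-- For `k = 0` the adjoint of index `-1` has index `k - 2 + 1 = -1` again, so nonnegative products
give no access to it; centrality of `a_(-1)` is used instead. -/
theorem pct_Y_of_mem_W_zero (hC : X.IsAdjointInvolution s C) (ha : a ∈ X.W 0) (n : ℤ) (b : V) :
    X.pct C (X.Y a n b) = X.Y (X.pct C a) n (X.pct C b) := by
  have hM := hC.mobius
  have ha' := pct_mem_W hC ha
  by_cases hn : n = -1
  swap
  · rw [Y_of_mem_W_zero hM ha hn, Y_of_mem_W_zero hM ha' hn, LinearMap.zero_apply, map_zero,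
      LinearMap.zero_apply]
  subst hn
  have ha1 := X.L_one_eq_zero hM (by norm_num) ha
  have ha1' := X.L_one_eq_zero hM (by norm_num) ha'
  refine X.quasiPrimary_induction hM
    (P := fun b => X.pct C (X.Y a (-1) b) = X.Y (X.pct C a) (-1) (X.pct C b))
    (fun l b hb hb1 => ?_) (fun l b _ hb => ?_)
    (fun b b' hb hb' => by simp only [map_add, hb, hb']) b
  · have hb' := pct_mem_W hC hb
    have hb1' : X.L 1 (X.pct C b) = 0 := by rw [← pct_L_one hC, hb1, map_zero]
    have hW : X.Y a (-1) b ∈ X.W l := by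
      have := X.Y_mem_W ha hb (-1)
      rwa [show 0 + l - 2 * -1 - 2 = l by ring] at this
    have hW' : X.Y (X.pct C a) (-1) (X.pct C b) ∈ X.W l := by
      have := X.Y_mem_W ha' hb' (-1)
      rwa [show 0 + l - 2 * -1 - 2 = l by ring] at this
    have h1 : X.L 1 (X.Y (X.pct C a) (-1) (X.pct C b)) = 0 := by
      rw [X.L_one_Y ha' ha1' hb1', Y_of_mem_W_zero hM ha' (by norm_num), LinearMap.zero_apply,
        smul_zero]
    have key : C (X.Y a (-1) b) = weightSign l • X.Y (X.pct C a) (-1) (X.pct C b) := by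
      refine hC.eq_of_adj fun h => ?_
      by_cases he : Even (h + l)
      · obtain ⟨m, hm⟩ := he
        rw [map_smul, X.mode_eq (n := m - 1) hW (by omega),
          X.mode_eq (n := l - 2 - (m - 1)) hW' (by omega), Y_Y_of_mem_W_zero hM ha hb,
          Y_Y_of_mem_W_zero hM ha' hb', commute_of_mem_W_zero hM ha']
        have := (adj_Y hC ha ha1 (-1)).mul (adj_Y hC hb hb1 (m - 1))
        simpa [weightSign] using this
      · rw [X.mode_of_not_even hW he, map_smul, X.mode_of_not_even hW', smul_zero]
        · exact adj_zero
        · rwa [Int.even_add, even_neg, ← Int.even_add]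
    rw [pct_apply, key, map_smul, X.flip_of_L_one_eq_zero hW' h1, smul_smul, weightSign_mul_self,
      one_smul]
  · rw [Y_apply_T, map_add, pct_T hC, hb, pct_T hC, Y_apply_T, map_smulₛₗ,
      Y_of_mem_W_zero hM ha (n := -1 - 1) (by norm_num),
      Y_of_mem_W_zero hM ha' (n := -1 - 1) (by norm_num)]
    simp

end Central

theorem pct_Y_of_quasiPrimary (hC : X.IsAdjointInvolution s C) {k : ℤ} {a : V} (ha : a ∈ X.W k)
    (ha1 : X.L 1 a = 0) {n : ℤ} (hn : 0 < k → 0 ≤ n) (b : V) :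
    X.pct C (X.Y a n b) = X.Y (X.pct C a) n (X.pct C b) := by
  rcases lt_trichotomy k 0 with hk | rfl | hk
  · rw [X.W_eq_bot_of_neg hC.mobius hk, Submodule.mem_bot] at ha
    simp [ha]
  · exact pct_Y_of_mem_W_zero hC ha n b
  · obtain ⟨m, rfl⟩ := Int.eq_ofNat_of_zero_le (hn hk)
    exact pct_Y_natCast hC ha ha1 m b

theorem inner_pct_vacuum (hC : X.IsAdjointInvolution s C) (x : V) :
    s.inner (X.pct C x) X.Ω = s.inner X.Ω x := by
  refine X.W_induction (P := fun x => s.inner (X.pct C x) X.Ω = s.inner X.Ω x)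
    (fun k x hx => ?_) (fun x y hx hy => by
      rw [map_add, inner_add_left, inner_add_right, hx, hy]) x
  have hx' := pct_mem_W hC hx
  by_cases hk : k = 0
  · subst hk
    have h := adj_Y hC hx' (X.L_one_eq_zero hC.mobius (by norm_num) hx') (-1) X.Ω X.Ω
    rw [pct_pct hC, X.creation] at h
    simpa [weightSign, X.creation] using h
  · rw [X.inner_eq_zero_of_ne hC.mobius.L_zero hk hx' X.vacuum_mem_W,
      X.inner_eq_zero_of_ne hC.mobius.L_zero (Ne.symm hk) X.vacuum_mem_W hx]

/-- The operator `θ` is antiunitary. -/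
theorem inner_pct_pct (hC : X.IsAdjointInvolution s C) (a b : V) :
    s.inner (X.pct C b) (X.pct C a) = s.inner a b := by
  refine X.quasiPrimary_induction hC.mobius
    (P := fun a => ∀ b, s.inner (X.pct C b) (X.pct C a) = s.inner a b)
    (fun k a ha ha1 b => ?_) (fun k a _ h b => ?_)
    (fun a a' h h' b => by rw [map_add, inner_add_left, inner_add_right, h, h']) a b
  · have ha' := pct_mem_W hC ha
    have ha1' : X.L 1 (X.pct C a) = 0 := by rw [← pct_L_one hC, ha1, map_zero]
    -- Write `a = a_(-1) Ω` and move `a_(-1)` to the right; the adjoint has index `k - 1`, where for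
    -- `k > 0`, as for `k ≤ 0`, preservation of products is already known.
    have h1 := adj_Y hC ha ha1 (-1) X.Ω b
    have h2 := adj_Y hC ha' ha1' (-1) X.Ω (X.pct C b)
    have h3 := pct_Y_of_quasiPrimary hC ha' ha1' (n := k - 2 - -1) (fun _ => by omega) b
    rw [X.creation, LinearMap.smul_apply, inner_smul_right] at h1 h2
    rw [pct_pct hC] at h2 h3
    rw [← inner_conj, h2, ← h3, map_mul, star_weightSign, inner_conj, inner_pct_vacuum hC, h1]
  · rw [pct_T hC, ← hC.mobius.L_one, ← pct_L_one hC, h, hC.mobius.L_one.symm]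

theorem pct_Y (hC : X.IsAdjointInvolution s C) (a b : V) (n : ℤ) :
    X.pct C (X.Y a n b) = X.Y (X.pct C a) n (X.pct C b) := by
  refine X.quasiPrimary_induction hC.mobius
    (P := fun a => ∀ (n : ℤ) (b : V), X.pct C (X.Y a n b) = X.Y (X.pct C a) n (X.pct C b))
    (fun k a ha ha1 n b => ?_) (fun k a _ h n b => ?_)
    (fun a a' h h' n b => by
      simp only [map_add, Pi.add_apply, LinearMap.add_apply, h, h']) a n b
  · by_cases hn : 0 < k → 0 ≤ n
    · exact pct_Y_of_quasiPrimary hC ha ha1 hn b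
    push Not at hn
    have ha' := pct_mem_W hC ha
    have ha1' : X.L 1 (X.pct C a) = 0 := by rw [← pct_L_one hC, ha1, map_zero]
    -- Now `0 < k` and `n < 0`, so the adjoint index `k - 2 - n` is nonnegative; antiunitarity
    -- carries the known identity back to index `n`.
    refine eq_of_inner s fun x => ?_
    rw [← pct_pct hC x]
    set c := X.pct C x
    have h3 := pct_Y_of_quasiPrimary hC ha' ha1' (n := k - 2 - n) (fun _ => by omega) c
    rw [pct_pct hC] at h3
    rw [inner_pct_pct hC, adj_Y hC ha ha1, LinearMap.smul_apply, inner_smul_right,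
      ← inner_pct_pct hC, h3, adj_Y hC ha ha1, LinearMap.smul_apply, inner_smul_right, ← mul_assoc,
      weightSign_mul_self, one_mul, sub_sub_cancel]
  · rw [pct_T hC, Y_T, Y_T, LinearMap.smul_apply, LinearMap.smul_apply, map_smulₛₗ, h]
    simp

theorem isPCT_pct (hC : X.IsAdjointInvolution s C) : X.IsPCT s (X.pct C) where
  map_product := pct_Y hC
  map_vacuum := pct_vacuum hC
  map_conformal := pct_conformal hC
  involutive := pct_pct hC
  invariant := pct_isInvariant hC

end Automorphism

end VOSA

end VertexSuper

/-! ### From local adjoints to an adjoint involution -/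

namespace VertexSuper

open Module

namespace VOSA

variable {V : Type*} [AddCommGroup V] [Module ℂ V] {X : VOSA V} {s : InnerProductSpace.Core ℂ V}

theorem Γ_mul_mul_Γ_of_shift (X : VOSA V) {A : End ℂ V} {r : ℤ}
    (hA : ∀ j, ∀ x ∈ X.W j, A x ∈ X.W (j + r)) :
    X.Γ * A * X.Γ = paritySign (r : ZMod 2) • A := by
  ext x
  refine X.W_induction (P := fun x => (X.Γ * A * X.Γ) x = (paritySign (r : ZMod 2) • A) x)
    (fun j x hx => ?_) (fun x y hx hy => by rw [map_add, map_add, hx, hy]) x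
  rw [End.mul_apply, End.mul_apply, X.parity_of_mem_W hx, map_smul, map_smul,
    X.parity_of_mem_W (hA j x hx), smul_smul, LinearMap.smul_apply]
  push_cast
  rw [paritySign_add, ← mul_assoc, paritySign_mul_self, one_mul]

/-- The adjoint of a local quasi-primary field is a quasi-primary field. -/
theorem exists_Y_adj (hM : X.HasUnitaryMobiusSymmetry s) {k : ℤ} {a : V} (ha : a ∈ X.W k)
    (h1 : X.L 1 a = 0) (hloc : X.HasLocalAdjoint s a) :
    ∃ y ∈ X.W k, ∀ n, Adj s (X.Y a n) (X.Y y (k - 2 - n)) := by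
  obtain ⟨B, hB, hBloc⟩ := hloc
  have hadj : ∀ n, Adj s (X.Y a n) (B n) := fun n => (hB n).adj
  -- With this reindexing `D n` shifts weights like the `n`-th product with a vector of weight `k /
  -- 2`.
  set D : ℤ → End ℂ V := fun n => B (k - 2 - n) with hD
  have hshift : ∀ n j, ∀ x ∈ X.W j, D n x ∈ X.W (j + (k - 2 * n - 2)) := by
    intro n j x hx
    have := X.adj_shift hM.L_zero (r := k - 2 * (k - 2 - n) - 2) (fun i x hx => by
      have := X.Y_mem_W ha hx (k - 2 - n)
      rwa [show k + i - 2 * (k - 2 - n) - 2 = i + (k - 2 * (k - 2 - n) - 2) by ring] at this)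
      (hadj (k - 2 - n)) j hx
    rwa [show j - (k - 2 * (k - 2 - n) - 2) = j + (k - 2 * n - 2) by ring] at this
  have hpar : ∀ n, X.Γ * D n * X.Γ = paritySign (k : ZMod 2) • D n := by
    intro n
    rw [X.Γ_mul_mul_Γ_of_shift (hshift n), paritySign_intCast, paritySign_intCast,
      show k - 2 * n - 2 = k + 2 * (-n - 1) by ring, zpow_add₀ (by norm_num),
      (even_two_mul _).neg_one_zpow, mul_one]
  have hW : D (-1) X.Ω ∈ X.W k := by
    have := hshift (-1) 0 _ X.vacuum_mem_W
    rwa [show 0 + (k - 2 * -1 - 2) = k by ring] at this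
  have hcov : X.Covariant D := by
    refine ⟨fun n => ?_, k.toNat, fun n hn => ?_⟩
    -- Translation covariance is the adjoint of the commutator of `L_1` with a quasi-primary field.
    · have e1 := ((hadj (k - 2 - n)).mul hM.L_one).sub (hM.L_one.mul (hadj (k - 2 - n)))
      have e2 := (hadj (k - 2 - n + 1)).smul (-(n : ℂ))
      have e3 : X.Y a (k - 2 - n) * X.L 1 - X.L 1 * X.Y a (k - 2 - n) =
          -(n : ℂ) • X.Y a (k - 2 - n + 1) := by
        rw [← neg_sub (X.L 1 * _), X.L_one_comm_quasiPrimary ha h1, ← neg_smul]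
        congr 1
        push_cast
        ring
      rw [e3] at e1
      have e4 := e1.unique e2
      simp only [hD]
      rw [e4, show k - 2 - (n - 1) = k - 2 - n + 1 by ring]
      simp
    · have := hshift n 0 _ X.vacuum_mem_W
      rw [X.W_eq_bot_of_neg hM (by omega)] at this
      simpa using this
  have hDY : D = X.Y (D (-1) X.Ω) := by
    refine hcov.eq_Y (X.parity_of_mem_W hW) rfl fun t b hb => ?_
    refine MutuallyLocal.signLocal (Γ := X.Γ) ?_ hpar (X.Γ_Y_Γ hb)
    have := (hBloc b).shift (-k)
    convert this using 1
    funext n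
    simp only [hD]
    congr 1
    ring
  refine ⟨_, hW, fun n => ?_⟩
  rw [← hDY]
  have := hadj n
  rwa [show B n = D (k - 2 - n) by simp [hD]] at this

theorem exists_mode_adj (hM : X.HasUnitaryMobiusSymmetry s) (hloc : ∀ a, X.HasLocalAdjoint s a)
    (a : V) : ∃ y, ∀ h, Adj s (X.mode h a) (X.mode (-h) y) := by
  refine X.quasiPrimary_induction hM
    (P := fun a => ∃ y, ∀ h, Adj s (X.mode h a) (X.mode (-h) y)) (fun k a ha h1 => ?_)
    -- By `mode_T_add`, the mode of `T a` is `-(h / 2) - k / 2` times that of `a`; on the adjoint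
    -- side `-(T + L_0)` realises the scalar `-(h / 2)`.
    (fun k a ha ⟨y, hy⟩ => ⟨-(X.T y + X.L 0 y) - ((k : ℂ) / 2) • y, fun h => ?_⟩)
    (fun a b ⟨y, hy⟩ ⟨z, hz⟩ => ⟨y + z, fun h => by
      rw [map_add, map_add]
      exact (hy h).add (hz h)⟩) a
  · obtain ⟨y, hyW, hy⟩ := exists_Y_adj hM ha h1 (hloc a)
    refine ⟨y, fun h => ?_⟩
    by_cases he : Even (h + k)
    · obtain ⟨n, hn⟩ := he
      rw [X.mode_eq (n := n - 1) ha (by omega),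
        X.mode_eq (n := k - 2 - (n - 1)) hyW (by omega)]
      exact hy _
    · rw [X.mode_of_not_even ha he, X.mode_of_not_even hyW]
      · exact adj_zero
      · rwa [Int.even_add, even_neg, ← Int.even_add]
  · have h1 := X.mode_T_add h a
    rw [map_add, X.mem_W.mp ha, map_smul] at h1
    have h2 := (hy h).smul (-((h : ℂ) / 2) - (k : ℂ) / 2)
    rw [eq_sub_of_add_eq h1, map_sub, map_neg, mode_T_add, map_smul, ← sub_smul]
    convert h2 using 1
    rw [map_sub, map_neg, map_div₀, map_div₀, map_ofNat, map_intCast, map_intCast]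
    push_cast
    module

/-- Uniqueness of adjoints makes `C` antilinear and involutive; the assumption on `V_0` serves to
prove `C ν = ν`. -/
theorem exists_isAdjointInvolution (h0 : X.W 0 = Submodule.span ℂ {X.Ω})
    (hM : X.HasUnitaryMobiusSymmetry s) (hloc : ∀ a, X.HasLocalAdjoint s a) :
    ∃ C : V →ₗ⋆[ℂ] V, X.IsAdjointInvolution s C := by
  choose f hf using exists_mode_adj hM hloc
  have huniq : ∀ {a y : V}, (∀ h, Adj s (X.mode h a) (X.mode (-h) y)) → f a = y := by
    intro a y hy
    refine X.eq_of_mode_eq fun n => ?_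
    have h1 := hf a (-n)
    have h2 := hy (-n)
    rw [neg_neg] at h1 h2
    exact h1.unique h2
  let C : V →ₗ⋆[ℂ] V :=
    { toFun := f
      map_add' := fun a b => huniq fun h => by
        rw [map_add, map_add]
        exact (hf a h).add (hf b h)
      map_smul' := fun r a => huniq fun h => by
        rw [map_smul, map_smul]
        exact (hf a h).smul r }
  refine ⟨C, ⟨fun a => huniq fun h => ?_, ?_, fun a b c h => hf a h b c⟩⟩
  · have := (hf a (-h)).symm
    rwa [neg_neg] at this
  change f X.ν = X.ν
  obtain ⟨y, hyW, hy⟩ := exists_Y_adj hM X.conformal_mem_W X.L_one_conformal (hloc X.ν)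
  have hfy : f X.ν = y := huniq fun h => by
    by_cases he : Even h
    · obtain ⟨n, hn⟩ := he
      rw [X.mode_eq (n := n + 1) X.conformal_mem_W (by omega),
        X.mode_eq (n := 4 - 2 - (n + 1)) hyW (by omega)]
      exact hy _
    · have h4 : Even (4 : ℤ) := by decide
      rw [X.mode_of_not_even X.conformal_mem_W (by rwa [Int.even_add, iff_true_right h4]),
        X.mode_of_not_even hyW (by rwa [Int.even_add, iff_true_right h4, even_neg])]
      exact adj_zero
  rw [hfy, ← sub_eq_zero]
  set x := y - X.ν with hx
  have hxW : x ∈ X.W 4 := sub_mem hyW X.conformal_mem_W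
  -- Möbius symmetry already fixes the adjoints of `L_{-1}`, `L_0`, `L_1`, so `y` and `ν` agree in
  -- these three modes.
  have hx0 : ∀ n : ℤ, n ∈ ({-1, 0, 1} : Set ℤ) → X.Y x (n + 1) = 0 := by
    intro n hn
    have hn' : -n ∈ ({-1, 0, 1} : Set ℤ) := by
      rcases hn with rfl | rfl | rfl <;> simp
    have h1 := hy (4 - 2 - (n + 1))
    have h2 : Adj s (X.L (-n)) (X.L (- -n)) := hM (-n) hn'
    rw [neg_neg] at h2
    rw [sub_sub_cancel, show 4 - 2 - (n + 1) = -n + 1 by ring] at h1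
    rw [hx, map_sub, Pi.sub_apply, h1.unique h2, L, sub_self]
  -- These are the terms of `[x_(-1), L_0]`. For `l = 3`, `x_(3) ν` is a multiple of `Ω`, whose
  -- field has no coefficient of index `-3`; for larger `l` the weight is negative.
  have hterm : ∀ l : ℕ, X.Y (X.Y x l X.ν) (-l) = 0 := by
    intro l
    have hW := X.Y_mem_W hxW X.conformal_mem_W l
    rcases lt_trichotomy l 3 with hl | rfl | hl
    · have := hx0 ((l : ℤ) - 1) (by
        simp only [Set.mem_insert_iff, Set.mem_singleton_iff]
        omega)
      rw [sub_add_cancel] at this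
      rw [this]
      simp
    · norm_num at hW
      rw [h0, Submodule.mem_span_singleton] at hW
      obtain ⟨c, hc⟩ := hW
      norm_num
      rw [← hc, map_smul, Pi.smul_apply, X.vacuum_field]
      simp
    · rw [X.W_eq_bot_of_neg hM (by omega), Submodule.mem_bot] at hW
      rw [hW]
      simp
  obtain ⟨N, hN⟩ := X.field x X.ν
  have h := X.comm_eq_productSum (X.parity_of_mem_W hxW) (X.parity_of_mem_W X.conformal_mem_W) hN
    0 (-1) 1
  rw [X.comm_zero, VertexSuperalgebra.productSum, Finset.sum_eq_zero, parity_mul] at h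
  -- Applied to `Ω`, the vanishing commutator gives `L_0 x = 0`, while `x` has weight `2`.
  · have h2 := LinearMap.congr_fun h X.Ω
    rw [← L_zero_eq] at h2
    norm_num [X.creation, X.L_zero_vacuum, X.mem_W.mp hxW] at h2
    exact h2
  · intro l _
    have := hterm l
    simp [this]

end VOSA

end VertexSuper

/-! ### The theorem -/

theorem mainTheorem7 {V : Type*} [AddCommGroup V] [Module ℂ V] (X : VertexSuper.VOSA V)
    (s : InnerProductSpace.Core ℂ V) (hs : X.IsNormalized s) :
    (X.HasUnitaryMobiusSymmetry s →
      ∀ (a : V) (n : ℤ), ∃ B : Module.End ℂ V, VertexSuper.VOSA.IsAdjoint s (X.Y a n) B) ∧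
    (X.W 0 = Submodule.span ℂ {X.Ω} →
      (X.IsUnitary s ↔ X.HasUnitaryMobiusSymmetry s ∧ ∀ a : V, X.HasLocalAdjoint s a)) ∧
    (X.IsUnitary s ↔ ∃ C : V →ₗ⋆[ℂ] V, X.IsAdjointInvolution s C) ∧
    (∀ C : V →ₗ⋆[ℂ] V, X.IsAdjointInvolution s C →
      C X.Ω = X.Ω ∧
      ∀ θ : V →ₗ⋆[ℂ] V, X.IsPCT s θ → ∀ a : V, C a = X.expLOne (X.signOp (θ a))) := by
  refine ⟨fun hM a n => ?_, fun h0 => ⟨?_, ?_⟩, ⟨?_, ?_⟩, fun C hC => ⟨hC.map_vacuum, ?_⟩⟩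
  · obtain ⟨B, hB⟩ := X.exists_adj_Y hM.L_zero a n
    exact ⟨B, hB.isAdjoint⟩
  · rintro ⟨-, θ, hθ⟩
    exact ⟨hθ.isAdjointInvolution.mobius, hθ.hasLocalAdjoint⟩
  · rintro ⟨hM, hloc⟩
    obtain ⟨C, hC⟩ := VertexSuper.VOSA.exists_isAdjointInvolution h0 hM hloc
    exact ⟨hs, _, VertexSuper.VOSA.isPCT_pct hC⟩
  · rintro ⟨-, θ, hθ⟩
    exact ⟨_, hθ.isAdjointInvolution⟩
  · rintro ⟨C, hC⟩
    exact ⟨hs, _, VertexSuper.VOSA.isPCT_pct hC⟩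
  · intro θ hθ a
    exact hC.eq_of_adj fun n => hθ.adj n a
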